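/- **Setting.** Let $n\in\{2,3\}$ and $k\ge 1$. Let $\Omega\subset\mathbb R^n$ be a bounded connected Lipschitz polyhedral domain with a disjoint partition $\partial\Omega=\Gamma_0\cup\Gamma_1$, $\Gamma_0$ of positive surface measure. Let $\mathcal T_h$ be obtained from a conforming quasi-uniform simplicial mesh of $\Omega$, whose boundary faces each lie on $\Gamma_0$ or on $\Gamma_1$, by splitting each simplex into $n+1$ simplices through connecting its vertices to its barycentre. Quasi-uniform with constant $\kappa>0$ means that every simplex of the unsplit mesh contains a ball of radius $\kappa$ times the diameter of every simplex of that mesh. Let $h$ be the largest diameter of an element of $\mathcal T_h$ and $\varepsilon_h$ the set of all faces. Let $\rho_S>0$ be a constant, and $$\mathcal A\tau=\frac1{2\mu_S}\tau^D+\frac{1}{n(n\lambda_S+2\mu_S)}(\operatorname{tr}\tau)I,\qquad \tau^D=\tau-\tfrac1n(\operatorname{tr}\tau) I,$$ with Lamé coefficients $\mu_S>0$, $n\lambda_S+2\mu_S>0$ that are constant on each element of $\mathcal T_h$. Let $p^m$ denote polynomials of degree at most $m$ and put - $\widetilde V^h=\{\upsilon:\ \upsilon|_K\in p^{k+1}(K)^{n\times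 n}\ \forall K\in\mathcal T_h\}$, $W^h=\{\omega:\ \omega|_K\in p^{k}(K)^{n}\ \forall K\}$, $A^h=\{\eta\in\widetilde V^h:\ \eta+\eta^t=0\}$, - $M^h=\{\mu:\ \mu|_F\in p^{k+1}(F)^n\ \forall F\in\varepsilon_h,\ \mu|_{\Gamma_0}=0\}$. Let $(\cdot,\cdot)=\sum_K(\cdot,\cdot)_K$, let $\langle\mu,\upsilon\nu\rangle=\sum_K\int_{\partial K}\mu\cdot\upsilon\nu\,ds$ with $\nu$ the outward unit normal of $K$, and let $\operatorname{div}$ be taken row-wise and elementwise. For $\mu\in M^h$ let $(\mathcal Q_1\mu,\mathcal Q_2\mu,\mathcal Q_3\mu)\in\widetilde V^h\times W^h\times A^h$ be the solution $(\sigma,u,\rho)$ of $$(\mathcal A\sigma,\upsilon)+(u,\operatorname{div}\upsilon)+(\rho,\upsilon)=-\langle\mu,\upsilon\nu\rangle,\quad (\rho_S^{-1}\operatorname{div}\sigma,\omega)=0,\quad(\sigma,\eta)=0\qquad\forall(\upsilon,\omega,\eta)\in\widetilde V^h\times W^h\times A^h,$$ and for $f\in W^h$ let $(\mathcal Q_1^Lf,\mathcal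 Q_2^Lf,\mathcal Q_3^Lf)$ be the solution of the same system with right-hand sides $0$, $-(f,\omega)$, $0$. Put $a_h(\mu_1,\mu_2)=(\rho_S^{-1}\mathcal A\mathcal Q_1\mu_1,\mathcal Q_1\mu_2)$. The hybridized mixed eigenproblem for $\lambda_h\in\mathbb R$ and $(\sigma_h,u_h,\rho_h,\gamma_h)\in\widetilde V^h\times W^h\times A^h\times M^h$ is $$\begin{aligned}(\mathcal A\sigma_h,\upsilon)+(u_h,\operatorname{div}\upsilon)+(\rho_h,\upsilon)+\langle\gamma_h,\upsilon\nu\rangle&=0,&-(\rho_S^{-1}\operatorname{div}\sigma_h,\omega)&=\lambda_h(u_h,\omega),\\(\sigma_h,\eta)&=0,&\langle\mu,\sigma_h\nu\rangle&=0\end{aligned}\tag{E}$$ for all $(\upsilon,\omega,\eta,\mu)\in\widetilde V^h\times W^h\times A^h\times M^h$. **Theorem.** The local systems are uniquely solvable, so the operators above are well defined. Given $n$, $k$, $\rho_S$, $\kappa$ and $M>0$, there is a constant $C^\star>0$ such that, for every domain and mesh as above with quasi-uniformity constant $\kappa$ and all $\lambda_S,\mu_S$ as above with $|\mathcal A\tau|\le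 M|\tau|$ (Frobenius norm) on every element (thus $C^\star$ is independent of $h$ and of $\mathcal A^{-1}$), every real $\lambda_h\le C^\star h^{-2}$ satisfies: 1. $I-\lambda_h\mathcal Q_2^L$ is invertible on $W^h$. 2. For each nonzero $\gamma_h\in M^h$, one has $$a_h(\gamma_h,\mu)=\lambda_h\big((I-\lambda_h\mathcal Q_2^L)^{-1}\mathcal Q_2\gamma_h,\mathcal Q_2\mu\big)\qquad\forall\mu\in M^h$$ if and only if $\lambda_h$ and the functions $$\gamma_h,\quad u_h=(I-\lambda_h\mathcal Q_2^L)^{-1}\mathcal Q_2\gamma_h,\quad \sigma_h=\mathcal Q_1\gamma_h+\lambda_h\mathcal Q_1^Lu_h,\quad\rho_h=\mathcal Q_3\gamma_h+\lambda_h\mathcal Q_3^Lu_h$$ together satisfy (E). 3. Every nonzero solution $(\sigma_h,u_h,\rho_h,\gamma_h)$ of (E) has $\gamma_h\ne0$ and is given by the formulas in 2. -/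

import Mathlib

open MeasureTheory

namespace HybridElasticity

noncomputable section

/-- Points of `ℝⁿ` with the Euclidean norm. -/
abbrev Pt (n : ℕ) : Type := EuclideanSpace ℝ (Fin n)

/-- The closed simplex spanned by a finite set of vertices. -/
def hull {n : ℕ} (K : Finset (Pt n)) : Set (Pt n) := convexHull ℝ (K : Set (Pt n))

/-- The barycentre of a nonempty finite set of points. -/
def barycentre {n : ℕ} (s : Finset (Pt n)) : Pt n := (s.card : ℝ)⁻¹ • ∑ v ∈ s, v

/-- Lipschitz boundary: near each boundary point, `U` is the set of points that lie above the
graph of a Lipschitz function, the vertical direction being a unit vector `ν`. -/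
def HasLipschitzBoundary {n : ℕ} (U : Set (Pt n)) : Prop :=
  ∀ x ∈ frontier U, ∃ (ν : Pt n) (φ : Pt n → ℝ) (L : NNReal) (r : ℝ),
    ‖ν‖ = 1 ∧ LipschitzWith L φ ∧ (∀ (y : Pt n) (t : ℝ), φ (y + t • ν) = φ y) ∧ 0 < r ∧
      ∀ y ∈ Metric.ball x r, (y ∈ U ↔ φ y < inner ℝ ν y)

/-- A bounded connected Lipschitz domain `Ω` with a disjoint partition `∂Ω = Γ₀ ∪ Γ₁`, where `Γ₀`
has positive surface measure. (That `Ω` is polyhedral follows from the existence of a mesh.) -/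
structure MixedDomain (n : ℕ) where
  Ω : Set (Pt n)
  Γ₀ : Set (Pt n)
  Γ₁ : Set (Pt n)
  isOpen : IsOpen Ω
  isConnected : IsConnected Ω
  isBounded : Bornology.IsBounded Ω
  lipschitz : HasLipschitzBoundary Ω
  disjoint : Disjoint Γ₀ Γ₁
  union_eq : Γ₀ ∪ Γ₁ = frontier Ω
  pos : 0 < (μHE[n - 1] : Measure (Pt n)) Γ₀

/-- The data of a conforming simplicial mesh of `Ω` that respects the partition of the boundary.
Its members are the macro-simplices (given by their vertex sets); the finite element mesh is
obtained from it by barycentric splitting, see `SplitMesh.cells`. -/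
structure SplitMesh {n : ℕ} (D : MixedDomain n) where
  macro_ : Finset (Finset (Pt n))
  card_eq : ∀ s ∈ macro_, s.card = n + 1
  affineIndependent : ∀ s ∈ macro_, AffineIndependent ℝ (fun x : s => (x : Pt n))
  conforming : ∀ s ∈ macro_, ∀ t ∈ macro_,
    hull s ∩ hull t = convexHull ℝ ((s : Set (Pt n)) ∩ (t : Set (Pt n)))
  covers : (⋃ s ∈ macro_, hull s) = closure D.Ω
  boundary : ∀ s ∈ macro_, ∀ F ⊆ s, F.card = n → hull F ⊆ frontier D.Ω →
    intrinsicInterior ℝ (hull F) ⊆ D.Γ₀ ∨ intrinsicInterior ℝ (hull F) ⊆ D.Γ₁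

namespace SplitMesh

variable {n : ℕ} {D : MixedDomain n} (T : SplitMesh D)

/-- Quasi-uniformity of the macro-mesh with constant `κ`: every macro-simplex contains a ball whose
radius is at least `κ` times the diameter of any macro-simplex. -/
def QuasiUniform (κ : ℝ) : Prop :=
  ∀ s ∈ T.macro_, ∀ t ∈ T.macro_, ∃ c : Pt n,
    Metric.closedBall c (κ * Metric.diam (hull t)) ⊆ hull s

open scoped Classical in
/-- The elements `K ∈ 𝒯_h`: each macro-simplex is split into `n + 1` simplices by connecting its
vertices to its barycentre. -/
def cells : Finset (Finset (Pt n)) :=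
  T.macro_.biUnion fun s => s.image fun x => insert (barycentre s) (s.erase x)

open scoped Classical in
/-- The set `ε_h` of all `(n-1)`-dimensional faces of the elements. -/
def faces : Finset (Finset (Pt n)) :=
  T.cells.biUnion fun K => K.powersetCard n

/-- The mesh size `h`, the largest diameter of an element. -/
def meshSize : ℝ := ⨆ K : T.cells, Metric.diam (hull K.1)

end SplitMesh

/-! ### Polynomials on simplices -/

/-- Value of a polynomial at a point. -/
def evalAt {n : ℕ} (x : Pt n) (p : MvPolynomial (Fin n) ℝ) : ℝ := MvPolynomial.eval (fun i => x i) p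

theorem continuous_evalAt {n : ℕ} (p : MvPolynomial (Fin n) ℝ) :
    Continuous fun x : Pt n => evalAt x p :=
  (MvPolynomial.continuous_eval p).comp (by fun_prop)

theorem isCompact_hull {n : ℕ} (K : Finset (Pt n)) : IsCompact (hull K) :=
  K.finite_toSet.isCompact_convexHull ℝ

/-- The integral of a polynomial over the simplex `K`. -/
def cellInt {n : ℕ} (K : Finset (Pt n)) : MvPolynomial (Fin n) ℝ →ₗ[ℝ] ℝ where
  toFun p := ∫ x in hull K, evalAt x p
  map_add' p q := by
    have hi : ∀ p : MvPolynomial (Fin n) ℝ,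
        IntegrableOn (fun x : Pt n => evalAt x p) (hull K) := fun p =>
      (continuous_evalAt p).continuousOn.integrableOn_compact (isCompact_hull K)
    simp only [evalAt, map_add]
    exact integral_add (hi p) (hi q)
  map_smul' c p := by
    simp only [evalAt, MvPolynomial.smul_eval, RingHom.id_apply, smul_eq_mul]
    exact integral_const_mul _ _

/-- `ν` is the unit normal on the face `F` of `K` that points out of `K`. -/
def IsOutwardNormal {n : ℕ} (K F : Finset (Pt n)) (ν : Pt n) : Prop :=
  ‖ν‖ = 1 ∧ (∀ y ∈ F, ∀ z ∈ F, inner ℝ ν (y - z) = 0) ∧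
    ∀ x ∈ K, x ∉ F → ∀ y ∈ F, inner ℝ ν (x - y) < 0

/-- The outward unit normal of `K` on its face `F`. -/
def outwardNormal {n : ℕ} (K F : Finset (Pt n)) : Pt n :=
  Classical.epsilon (IsOutwardNormal K F)

/-- The surface measure on the face `F`. -/
def faceMeasure {n : ℕ} (F : Finset (Pt n)) : Measure (Pt n) :=
  (μHE[n - 1] : Measure (Pt n)).restrict (hull F)

theorem faceMeasure_lt_top {n : ℕ} (F : Finset (Pt n)) (hF : F.card = n) :
    faceMeasure F Set.univ < ⊤ := by
  rw [faceMeasure, Measure.restrict_apply_univ]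
  rcases F.eq_empty_or_nonempty with rfl | ⟨p, hp⟩
  · simp [hull]
  have hcard : Fintype.card (F.erase p) = n - 1 := by
    rw [Fintype.card_coe, Finset.card_erase_of_mem hp, hF]
  let A : ((F.erase p) → ℝ) →ₗ[ℝ] Pt n := Fintype.linearCombination ℝ fun v => v.1 - p
  have hA : LipschitzWith ‖A.toContinuousLinearMap‖₊ A := A.toContinuousLinearMap.lipschitz
  have hg : LipschitzWith ‖A.toContinuousLinearMap‖₊ fun t => A t + p := by
    intro x y
    simpa using hA x y
  have hsub : hull F ⊆ (fun t => A t + p) '' Set.Icc 0 1 := by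
    have hconv : Convex ℝ ((fun t => A t + p) '' Set.Icc 0 1) := by
      have h := ((convex_Icc (0 : (F.erase p) → ℝ) 1).linear_image A).translate p
      rw [Set.image_image] at h
      simpa only [add_comm] using h
    refine convexHull_min (fun v hv => ?_) hconv
    by_cases hvp : v = p
    · exact ⟨0, ⟨le_rfl, zero_le_one⟩, by simp [hvp]⟩
    · refine ⟨Pi.single ⟨v, Finset.mem_erase.2 ⟨hvp, hv⟩⟩ 1,
        ⟨Pi.single_nonneg.2 zero_le_one, ?_⟩, ?_⟩
      · intro i
        by_cases hi : i = ⟨v, Finset.mem_erase.2 ⟨hvp, hv⟩⟩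
        · subst hi; simp
        · simp [hi]
      · simp [A, Fintype.linearCombination_apply_single]
  have hfin : Measure.hausdorffMeasure ((n - 1 : ℕ) : ℝ) (hull F) < ⊤ := by
    refine (measure_mono hsub).trans_lt ?_
    refine (hg.hausdorffMeasure_image_le (Nat.cast_nonneg _) _).trans_lt ?_
    refine ENNReal.mul_lt_top (by simp) ?_
    rw [← hcard, hausdorffMeasure_pi_real]
    exact isCompact_Icc.measure_lt_top
  rw [Measure.euclideanHausdorffMeasure_def, Measure.smul_apply]
  exact ENNReal.mul_lt_top (by simp) hfin

/-! ### Broken spaces -/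

section Spaces

variable {n : ℕ} {D : MixedDomain n} (T : SplitMesh D)

/-- Vector fields that are polynomial on each element. -/
abbrev BrokenVec : Type := T.cells → Fin n → MvPolynomial (Fin n) ℝ

/-- Matrix fields that are polynomial on each element. -/
abbrev BrokenMat : Type := T.cells → Matrix (Fin n) (Fin n) (MvPolynomial (Fin n) ℝ)

/-- `(u, w)_{𝒯_h}` for vector fields. -/
def vecForm : BrokenVec T →ₗ[ℝ] BrokenVec T →ₗ[ℝ] ℝ :=
  LinearMap.mk₂ ℝ (fun u w => ∑ K, cellInt K.1 (∑ i, u K i * w K i))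
    (by intros; simp [add_mul, Finset.sum_add_distrib])
    (by intros; simp [Finset.mul_sum])
    (by intros; simp [mul_add, Finset.sum_add_distrib])
    (by intros; simp [Finset.mul_sum])

/-- `(τ, υ)_{𝒯_h}` for matrix fields. -/
def matForm : BrokenMat T →ₗ[ℝ] BrokenMat T →ₗ[ℝ] ℝ :=
  LinearMap.mk₂ ℝ (fun τ υ => ∑ K, cellInt K.1 (∑ i, ∑ j, τ K i j * υ K i j))
    (by intros; simp [add_mul, Finset.sum_add_distrib])
    (by intros; simp [Finset.mul_sum])
    (by intros; simp [mul_add, Finset.sum_add_distrib])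
    (by intros; simp [Finset.mul_sum])

/-- The elementwise, row-wise divergence. -/
def divMap : BrokenMat T →ₗ[ℝ] BrokenVec T where
  toFun τ := fun K i => ∑ j, MvPolynomial.pderiv j (τ K i j)
  map_add' _ _ := by ext1 K; ext1 i; simp [Finset.sum_add_distrib]
  map_smul' _ _ := by ext1 K; ext1 i; simp [Finset.smul_sum]

/-- Lamé coefficients `μ_S`, `λ_S`, constant on each element, for which the elasticity operator is
positive definite. -/
structure Lame where
  mu : T.cells → ℝ
  lam : T.cells → ℝ
  mu_pos : ∀ K, 0 < mu K
  bulk_pos : ∀ K, 0 < n * lam K + 2 * mu K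

variable {T}

/-- `𝒜 τ = (2μ_S)⁻¹ τᴰ + (n (n λ_S + 2 μ_S))⁻¹ (tr τ) I` on the element `K`, where
`τᴰ = τ - n⁻¹ (tr τ) I`; the entries of `τ` are numbers or polynomials. -/
def Lame.compliance (L : Lame T) (K : T.cells) {R : Type} [CommRing R] [Algebra ℝ R]
    (τ : Matrix (Fin n) (Fin n) R) : Matrix (Fin n) (Fin n) R :=
  (1 / (2 * L.mu K)) • (τ - (1 / (n : ℝ)) • (τ.trace • (1 : Matrix (Fin n) (Fin n) R))) +
    (1 / (n * (n * L.lam K + 2 * L.mu K))) • (τ.trace • (1 : Matrix (Fin n) (Fin n) R))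

/-- `𝒜` acting on broken polynomial matrix fields. -/
def Lame.complianceMap (L : Lame T) : BrokenMat T →ₗ[ℝ] BrokenMat T where
  toFun τ := fun K => L.compliance K (τ K)
  map_add' a b := by
    funext K
    simp only [Lame.compliance, Pi.add_apply, Matrix.trace_add, add_smul, smul_add, smul_sub]
    abel
  map_smul' c a := by
    funext K
    simp only [Lame.compliance, Pi.smul_apply, Matrix.trace_smul, RingHom.id_apply, smul_add,
      smul_sub, smul_assoc, smul_comm _ c]

/-- `‖𝒜‖ ≤ M`: on every element, `|𝒜 τ| ≤ M |τ|` in the Frobenius norm. -/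
def Lame.BoundedBy (L : Lame T) (M : ℝ) : Prop :=
  ∀ (K : T.cells) (τ : Matrix (Fin n) (Fin n) ℝ),
    ∑ i, ∑ j, L.compliance K τ i j ^ 2 ≤ M ^ 2 * ∑ i, ∑ j, τ i j ^ 2

variable (T) (k : ℕ)

/-- The discontinuous stress space `Ṽ^h`: matrices with entries in `p^{k+1}(K)` on each `K`. -/
def stressSpace : Submodule ℝ (BrokenMat T) where
  carrier := {τ | ∀ K i j, τ K i j ∈ MvPolynomial.restrictTotalDegree (Fin n) ℝ (k + 1)}
  add_mem' ha hb K i j := Submodule.add_mem _ (ha K i j) (hb K i j)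
  zero_mem' _ _ _ := Submodule.zero_mem _
  smul_mem' c _ ha K i j := Submodule.smul_mem _ c (ha K i j)

/-- The displacement space `W^h`: vectors with entries in `p^k(K)` on each `K`. -/
def dispSpace : Submodule ℝ (BrokenVec T) where
  carrier := {u | ∀ K i, u K i ∈ MvPolynomial.restrictTotalDegree (Fin n) ℝ k}
  add_mem' ha hb K i := Submodule.add_mem _ (ha K i) (hb K i)
  zero_mem' _ _ := Submodule.zero_mem _
  smul_mem' c _ ha K i := Submodule.smul_mem _ c (ha K i)

/-- The rotation space `A^h`: skew-symmetric matrices with entries in `p^{k+1}(K)`. -/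
def rotSpace : Submodule ℝ (BrokenMat T) where
  carrier := {η | (∀ K i j, η K i j ∈ MvPolynomial.restrictTotalDegree (Fin n) ℝ (k + 1)) ∧
    ∀ K, η K + (η K).transpose = 0}
  add_mem' ha hb := ⟨fun K i j => Submodule.add_mem _ (ha.1 K i j) (hb.1 K i j), fun K => by
    have h := congrArg₂ (· + ·) (ha.2 K) (hb.2 K)
    simp only [add_zero] at h
    rw [← h, Pi.add_apply, Matrix.transpose_add]; abel⟩
  zero_mem' := ⟨fun _ _ _ => Submodule.zero_mem _, fun _ => by simp⟩
  smul_mem' c a ha := ⟨fun K i j => Submodule.smul_mem _ c (ha.1 K i j), fun K => by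
    rw [Pi.smul_apply, Matrix.transpose_smul, ← smul_add, ha.2 K, smul_zero]⟩

/-- The multiplier space `M^h`: on each face `F ∈ ε_h` a vector of functions in `p^{k+1}(F)`
(functions on `F` are extended by zero off `F`), vanishing on the faces that lie on `Γ₀`. -/
def traceSpace : Submodule ℝ (T.faces → Pt n → Fin n → ℝ) where
  carrier := {μ | (∀ F, ∃ p : Fin n → MvPolynomial.restrictTotalDegree (Fin n) ℝ (k + 1),
      μ F = (hull F.1).indicator fun x i => evalAt x (p i).1) ∧
    ∀ F, intrinsicInterior ℝ (hull F.1) ⊆ D.Γ₀ → μ F = 0}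
  add_mem' {a b} ha hb := ⟨fun F => by
      obtain ⟨p, hp⟩ := ha.1 F
      obtain ⟨q, hq⟩ := hb.1 F
      refine ⟨p + q, ?_⟩
      rw [Pi.add_apply, hp, hq]
      ext x i
      by_cases hx : x ∈ hull F.1 <;> simp [evalAt, hx],
    fun F hF => by rw [Pi.add_apply, ha.2 F hF, hb.2 F hF, add_zero]⟩
  zero_mem' := ⟨fun F => ⟨0, by
      ext x i
      by_cases hx : x ∈ hull F.1 <;> simp [evalAt, hx]⟩, fun _ _ => rfl⟩
  smul_mem' c a ha := ⟨fun F => by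
      obtain ⟨p, hp⟩ := ha.1 F
      refine ⟨c • p, ?_⟩
      rw [Pi.smul_apply, hp]
      ext x i
      by_cases hx : x ∈ hull F.1 <;> simp [evalAt, hx, MvPolynomial.smul_eval],
    fun F hF => by rw [Pi.smul_apply, ha.2 F hF, smul_zero]⟩

variable {T k}

theorem card_face (F : T.faces) : F.1.card = n := by
  obtain ⟨K, -, hK⟩ := Finset.mem_biUnion.1 F.2
  exact (Finset.mem_powersetCard.1 hK).2

/-- The integrand of `⟨μ, υ n⟩` on the face `F` of `K`, as a function of `x`. -/
def traceIntegrand (μ : T.faces → Pt n → Fin n → ℝ) (υ : BrokenMat T) (K : T.cells) (F : T.faces)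
    (x : Pt n) : ℝ :=
  ∑ i, μ F x i * ∑ j, evalAt x (υ K i j) * outwardNormal K.1 F.1 j

theorem integrable_traceIntegrand {μ : T.faces → Pt n → Fin n → ℝ} (hμ : μ ∈ traceSpace T k)
    (υ : BrokenMat T) (K : T.cells) (F : T.faces) :
    Integrable (traceIntegrand μ υ K F) (faceMeasure F.1) := by
  obtain ⟨p, hp⟩ := hμ.1 F
  let g : Pt n → ℝ := fun x =>
    ∑ i, evalAt x (p i).1 * ∑ j, evalAt x (υ K i j) * outwardNormal K.1 F.1 j
  have hg : Continuous g := continuous_finsetSum _ fun i _ => (continuous_evalAt _).mul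
    (continuous_finsetSum _ fun j _ => (continuous_evalAt _).mul continuous_const)
  have hfin : (μHE[n - 1] : Measure (Pt n)) (hull F.1) ≠ ⊤ := by
    have h := faceMeasure_lt_top F.1 (card_face F)
    rw [faceMeasure, Measure.restrict_apply_univ] at h
    exact h.ne
  have hI : IntegrableOn g (hull F.1) (μHE[n - 1] : Measure (Pt n)) :=
    hg.continuousOn.integrableOn_of_subset_isCompact (isCompact_hull _)
      (isCompact_hull _).measurableSet subset_rfl hfin
  refine hI.congr ?_
  filter_upwards [ae_restrict_mem (isCompact_hull F.1).measurableSet] with x hx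
  simp [g, traceIntegrand, hp, Set.indicator_of_mem hx]

open scoped Classical in
variable (T k) in
/-- `⟨μ, υ n⟩_{∂𝒯_h} = ∑_K ∫_{∂K} μ · (υ n) ds`. -/
def traceForm : traceSpace T k →ₗ[ℝ] stressSpace T k →ₗ[ℝ] ℝ :=
  LinearMap.mk₂ ℝ
    (fun μ υ => ∑ K : T.cells, ∑ F : T.faces with F.1 ⊆ K.1,
      ∫ x, traceIntegrand μ.1 υ.1 K F x ∂faceMeasure F.1)
    (by
      intro a b υ
      simp only [← Finset.sum_add_distrib]
      refine Finset.sum_congr rfl fun K _ => Finset.sum_congr rfl fun F _ => ?_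
      rw [← integral_add (integrable_traceIntegrand a.2 _ _ _)
        (integrable_traceIntegrand b.2 _ _ _)]
      simp [traceIntegrand, add_mul, Finset.sum_add_distrib])
    (by
      intro c a υ
      simp only [smul_eq_mul, Finset.mul_sum, ← integral_const_mul]
      refine Finset.sum_congr rfl fun K _ => Finset.sum_congr rfl fun F _ => ?_
      simp [traceIntegrand, Finset.mul_sum, mul_assoc])
    (by
      intro a υ w
      simp only [← Finset.sum_add_distrib]
      refine Finset.sum_congr rfl fun K _ => Finset.sum_congr rfl fun F _ => ?_
      rw [← integral_add (integrable_traceIntegrand a.2 _ _ _)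
        (integrable_traceIntegrand a.2 _ _ _)]
      simp [traceIntegrand, evalAt, add_mul, mul_add, Finset.sum_add_distrib])
    (by
      intro c a υ
      simp only [smul_eq_mul, Finset.mul_sum, ← integral_const_mul]
      refine Finset.sum_congr rfl fun K _ => Finset.sum_congr rfl fun F _ => ?_
      simp [traceIntegrand, evalAt, MvPolynomial.smul_eval, Finset.mul_sum, mul_assoc,
        mul_left_comm])

/-! ### Local solution operators -/

variable (T k)

/-- The broken product space `Ṽ^h × W^h × A^h`. -/
abbrev LocalSpace : Type := stressSpace T k × dispSpace T k × rotSpace T k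

variable {T} (ρS : ℝ) (L : Lame T)

/-- The bilinear form of the local systems: it sends `(σ, u, ρ)`, `(υ, ω, η)` to
`(𝒜σ, υ) + (u, div υ) + (ρ, υ) + (ρ_S⁻¹ div σ, ω) + (σ, η)`. -/
def localForm : LocalSpace T k →ₗ[ℝ] LocalSpace T k →ₗ[ℝ] ℝ :=
  LinearMap.mk₂ ℝ
    (fun x y => matForm T (L.complianceMap x.1) y.1 + vecForm T x.2.1 (divMap T y.1) +
      matForm T x.2.2 y.1 + ρS⁻¹ * vecForm T (divMap T x.1) y.2.1 + matForm T x.1 y.2.2)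
    (by intros; simp only [Prod.fst_add, Prod.snd_add, Submodule.coe_add, map_add,
          LinearMap.add_apply]; ring)
    (by intros; simp only [Prod.smul_fst, Prod.smul_snd, Submodule.coe_smul, map_smul,
          LinearMap.smul_apply, smul_eq_mul]; ring)
    (by intros; simp only [Prod.fst_add, Prod.snd_add, Submodule.coe_add, map_add]; ring)
    (by intros; simp only [Prod.smul_fst, Prod.smul_snd, Submodule.coe_smul, map_smul,
          smul_eq_mul]; ring)

open scoped Classical in
/-- The solution operator `ℓ ↦ x` of the local systems `localForm x y = ℓ y` for all `y`
(zero if these systems are not uniquely solvable). -/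
def localSolve : Module.Dual ℝ (LocalSpace T k) →ₗ[ℝ] LocalSpace T k :=
  if h : Function.Bijective (localForm k ρS L) then
    ((LinearEquiv.ofBijective (localForm k ρS L) h).symm :
      Module.Dual ℝ (LocalSpace T k) →ₗ[ℝ] LocalSpace T k)
  else 0

/-- `μ ↦ (𝒬₁ μ, 𝒬₂ μ, 𝒬₃ μ)`: the local solution with data `υ ↦ -⟨μ, υ n⟩` in the first
equation. -/
def Q : traceSpace T k →ₗ[ℝ] LocalSpace T k :=
  localSolve k ρS L ∘ₗ
    (-(LinearMap.lcomp ℝ ℝ (LinearMap.fst ℝ (stressSpace T k) (dispSpace T k × rotSpace T k)) ∘ₗ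
      traceForm T k))

/-- `f ↦ (𝒬₁ᴸ f, 𝒬₂ᴸ f, 𝒬₃ᴸ f)` for `f` in `W^h`: the local solution with data `ω ↦ -(f, ω)` in
the second equation. -/
def QL : dispSpace T k →ₗ[ℝ] LocalSpace T k :=
  localSolve k ρS L ∘ₗ
    (-(LinearMap.lcomp ℝ ℝ ((dispSpace T k).subtype ∘ₗ
        LinearMap.fst ℝ (dispSpace T k) (rotSpace T k) ∘ₗ
        LinearMap.snd ℝ (stressSpace T k) (dispSpace T k × rotSpace T k)) ∘ₗ
      vecForm T ∘ₗ (dispSpace T k).subtype))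

def Q₁ : traceSpace T k →ₗ[ℝ] stressSpace T k := LinearMap.fst ℝ _ _ ∘ₗ Q k ρS L

def Q₂ : traceSpace T k →ₗ[ℝ] dispSpace T k := LinearMap.fst ℝ _ _ ∘ₗ LinearMap.snd ℝ _ _ ∘ₗ Q k ρS L

def Q₃ : traceSpace T k →ₗ[ℝ] rotSpace T k := LinearMap.snd ℝ _ _ ∘ₗ LinearMap.snd ℝ _ _ ∘ₗ Q k ρS L

def QL₁ : dispSpace T k →ₗ[ℝ] stressSpace T k := LinearMap.fst ℝ _ _ ∘ₗ QL k ρS L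

def QL₂ : Module.End ℝ (dispSpace T k) := LinearMap.fst ℝ _ _ ∘ₗ LinearMap.snd ℝ _ _ ∘ₗ QL k ρS L

def QL₃ : dispSpace T k →ₗ[ℝ] rotSpace T k := LinearMap.snd ℝ _ _ ∘ₗ LinearMap.snd ℝ _ _ ∘ₗ QL k ρS L

/-- The condensed bilinear form `a_h(μ₁, μ₂) = (ρ_S⁻¹ 𝒜 𝒬₁ μ₁, 𝒬₁ μ₂)_{𝒯_h}`. -/
def condensedForm (μ₁ μ₂ : traceSpace T k) : ℝ :=
  ρS⁻¹ * matForm T (L.complianceMap (Q₁ k ρS L μ₁)) (Q₁ k ρS L μ₂)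

/-- The displacement `(I - λ_h 𝒬₂ᴸ)⁻¹ 𝒬₂ γ_h`. -/
def recDisp (lamh : ℝ) (γ : traceSpace T k) : dispSpace T k :=
  Ring.inverse (1 - lamh • QL₂ k ρS L) (Q₂ k ρS L γ)

/-- The stress `𝒬₁ γ_h + λ_h 𝒬₁ᴸ u_h`, where `u_h` is the reconstructed displacement. -/
def recStress (lamh : ℝ) (γ : traceSpace T k) : stressSpace T k :=
  Q₁ k ρS L γ + lamh • QL₁ k ρS L (recDisp k ρS L lamh γ)

/-- The rotation `𝒬₃ γ_h + λ_h 𝒬₃ᴸ u_h`, where `u_h` is the reconstructed displacement. -/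
def recRot (lamh : ℝ) (γ : traceSpace T k) : rotSpace T k :=
  Q₃ k ρS L γ + lamh • QL₃ k ρS L (recDisp k ρS L lamh γ)

/-- The nonlinear condensed eigenproblem
`a_h(γ_h, μ) = λ_h ((I - λ_h 𝒬₂ᴸ)⁻¹ 𝒬₂ γ_h, 𝒬₂ μ)` for all `μ ∈ M^h`. -/
def SolvesCondensed (lamh : ℝ) (γ : traceSpace T k) : Prop :=
  ∀ μ : traceSpace T k, condensedForm k ρS L γ μ =
    lamh * vecForm T (Ring.inverse (1 - lamh • QL₂ k ρS L) (Q₂ k ρS L γ)).1 (Q₂ k ρS L μ).1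

variable {k}

/-- The four equations of the hybridized mixed eigenproblem. -/
def SolvesHybrid (lamh : ℝ) (σ : stressSpace T k) (u : dispSpace T k) (ρ : rotSpace T k)
    (γ : traceSpace T k) : Prop :=
  (∀ υ : stressSpace T k, matForm T (L.complianceMap σ) υ + vecForm T u (divMap T υ) +
      matForm T ρ υ + traceForm T k γ υ = 0) ∧
  (∀ ω : dispSpace T k, -(ρS⁻¹ * vecForm T (divMap T σ) ω) = lamh * vecForm T u ω) ∧
  (∀ η : rotSpace T k, matForm T σ η = 0) ∧
  (∀ μ : traceSpace T k, traceForm T k μ σ = 0)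

end Spaces

end

end HybridElasticity

namespace HybridElasticity

noncomputable section

/-! ### Polynomials: antiderivatives and affine substitutions -/

/-! The analysis rests on a right inverse of the elementwise divergence. On a cell, a displacement
`f` is the divergence of the diagonal matrix whose `i`-th entry is an antiderivative of `f i` in the
variable `x i`. Stresses are discontinuous, so nothing has to match across faces, and a diagonal
matrix is orthogonal to every skew one, so weak symmetry is automatic (`exists_diagonal_divMap_eq`).
Scaling to reference balls gives `‖τ‖² ≤ C h² ‖f‖²` with `C` depending only on `n`, `k`, `κ`
(`exists_antideriv_bound`, `SplitMesh.QuasiUniform.exists_closedBall`).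

The local systems are square, so uniqueness suffices. Testing a homogeneous solution with itself
kills the stress, a diagonal stress with divergence `u` kills `u`, and the rotation used as a stress
kills itself (`localForm_injective`).

For `σ = 𝒬₁ᴸ f`, the energy identity is `ρ_S (f, 𝒬₂ᴸ f) = (𝒜σ, σ)`, and `σ` has least energy among
weakly symmetric stresses with divergence `-ρ_S f`. Comparison with the diagonal one gives `0 ≤ (f,
𝒬₂ᴸ f) ≤ M ρ_S C h² ‖f‖²`. Hence `f = λ 𝒬₂ᴸ f` forces `f = 0` once `λ M ρ_S C h² < 1`, for negative
`λ` too. Quantitatively only the upper bound on `𝒜` enters, whence the independence of `𝒜⁻¹`.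

The first three equations of (E) say that the volume unknowns are `𝒬γ + λ 𝒬ᴸu`; the displacement
component is a fixed-point equation, solved by inverting `I - λ 𝒬₂ᴸ`. Testing local problems against
one another shows that the remaining normal jump is `-ρ_S` times the residual of the condensed
equation (`traceForm_reconstruction`). -/

/-- The antiderivative in the `i`-th variable that vanishes for `x i = 0`. -/
def antideriv {n : ℕ} (i : Fin n) : MvPolynomial (Fin n) ℝ →ₗ[ℝ] MvPolynomial (Fin n) ℝ :=
  (MvPolynomial.basisMonomials (Fin n) ℝ).constr ℝ fun m =>
    MvPolynomial.monomial (m + Finsupp.single i 1) (((m i : ℝ) + 1)⁻¹)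

theorem antideriv_monomial {n : ℕ} (i : Fin n) (m : Fin n →₀ ℕ) (a : ℝ) :
    antideriv i (MvPolynomial.monomial m a) =
      MvPolynomial.monomial (m + Finsupp.single i 1) (a * ((m i : ℝ) + 1)⁻¹) := by
  have h : MvPolynomial.monomial m a = a • MvPolynomial.basisMonomials (Fin n) ℝ m := by
    simp [MvPolynomial.smul_monomial]
  rw [h, map_smul, antideriv, Module.Basis.constr_basis, MvPolynomial.smul_monomial, smul_eq_mul]

theorem pderiv_antideriv {n : ℕ} (i : Fin n) (p : MvPolynomial (Fin n) ℝ) :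
    MvPolynomial.pderiv i (antideriv i p) = p := by
  induction p using MvPolynomial.induction_on' with
  | monomial m a =>
    rw [antideriv_monomial, MvPolynomial.pderiv_monomial]
    have h : (m i : ℝ) + 1 ≠ 0 := by positivity
    simp [h]
  | add p q hp hq => rw [map_add, map_add, hp, hq]

theorem totalDegree_antideriv_le {n k : ℕ} (i : Fin n) {p : MvPolynomial (Fin n) ℝ}
    (hp : p.totalDegree ≤ k) : (antideriv i p).totalDegree ≤ k + 1 := by
  rw [p.as_sum, map_sum]
  refine MvPolynomial.totalDegree_finsetSum_le fun m hm => ?_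
  rw [antideriv_monomial]
  refine (MvPolynomial.totalDegree_monomial_le _ _).trans ?_
  rw [Finsupp.sum_add_index' (by simp) (by simp), Finsupp.sum_single_index rfl]
  exact Nat.add_le_add_right ((MvPolynomial.le_totalDegree hm).trans hp) 1

/-- The substitution `p ↦ p (c + h x)`. -/
def affineSubst {n : ℕ} (c : Pt n) (h : ℝ) :
    MvPolynomial (Fin n) ℝ →ₐ[ℝ] MvPolynomial (Fin n) ℝ :=
  MvPolynomial.aeval fun i => MvPolynomial.C (c i) + MvPolynomial.C h * MvPolynomial.X i

theorem evalAt_affineSubst {n : ℕ} (c : Pt n) (h : ℝ) (p : MvPolynomial (Fin n) ℝ) (x : Pt n) :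
    evalAt x (affineSubst c h p) = evalAt (c + h • x) p := by
  induction p using MvPolynomial.induction_on with
  | C a => simp [affineSubst, evalAt]
  | add p q hp hq =>
    simp only [evalAt, map_add] at *
    rw [hp, hq]
  | mul_X p i hp =>
    simp only [evalAt, map_mul] at *
    rw [hp]
    simp [affineSubst]

theorem pderiv_affineSubst {n : ℕ} (c : Pt n) (h : ℝ) (i : Fin n) (p : MvPolynomial (Fin n) ℝ) :
    MvPolynomial.pderiv i (affineSubst c h p) =
      MvPolynomial.C h * affineSubst c h (MvPolynomial.pderiv i p) := by
  induction p using MvPolynomial.induction_on with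
  | C a => simp [affineSubst]
  | add p q hp hq => simp only [map_add, hp, hq, mul_add]
  | mul_X p j hp =>
    simp only [map_mul, MvPolynomial.pderiv_mul, map_add, hp]
    have hX : MvPolynomial.pderiv i (affineSubst c h (MvPolynomial.X j)) =
        MvPolynomial.C h * affineSubst c h (MvPolynomial.pderiv i (MvPolynomial.X j)) := by
      rcases eq_or_ne j i with rfl | hji
      · simp [affineSubst]
      · simp [affineSubst, MvPolynomial.pderiv_X_of_ne hji]
    rw [hX]
    ring

theorem totalDegree_affineSubst_le {n : ℕ} (c : Pt n) (h : ℝ) (p : MvPolynomial (Fin n) ℝ) :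
    (affineSubst c h p).totalDegree ≤ p.totalDegree := by
  rw [affineSubst, MvPolynomial.aeval_def, MvPolynomial.eval₂_eq]
  refine MvPolynomial.totalDegree_finsetSum_le fun m hm => ?_
  refine (MvPolynomial.totalDegree_mul _ _).trans ?_
  rw [MvPolynomial.algebraMap_eq, MvPolynomial.totalDegree_C, zero_add]
  refine (MvPolynomial.totalDegree_finsetProd _ _).trans ?_
  refine le_trans (Finset.sum_le_sum fun i _ => ?_) (MvPolynomial.le_totalDegree hm)
  refine (MvPolynomial.totalDegree_pow _ _).trans ?_
  have h1 : (MvPolynomial.C (c i) + MvPolynomial.C h * MvPolynomial.X i :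
      MvPolynomial (Fin n) ℝ).totalDegree ≤ 1 :=
    (MvPolynomial.totalDegree_add _ _).trans
      (max_le (by simp) ((MvPolynomial.totalDegree_mul _ _).trans (by simp)))
  exact (Nat.mul_le_mul_left _ h1).trans (mul_one _).le

theorem affineSubst_affineSubst_inv {n : ℕ} (c : Pt n) {h : ℝ} (hh : h ≠ 0)
    (p : MvPolynomial (Fin n) ℝ) :
    affineSubst (-(h⁻¹ • c)) h⁻¹ (affineSubst c h p) = p := by
  refine MvPolynomial.funext fun x => ?_
  have h1 := evalAt_affineSubst (-(h⁻¹ • c)) h⁻¹ (affineSubst c h p) (WithLp.toLp 2 x)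
  rw [evalAt_affineSubst c, smul_add, smul_neg, smul_smul, smul_smul, mul_inv_cancel₀ hh, one_smul,
    one_smul, add_neg_cancel_left] at h1
  exact h1

/-! ### Integrals of polynomials -/

theorem integrableOn_evalAt {n : ℕ} {S : Set (Pt n)} (hS : IsCompact S)
    (p : MvPolynomial (Fin n) ℝ) : IntegrableOn (fun x : Pt n => evalAt x p) S :=
  (continuous_evalAt p).continuousOn.integrableOn_compact hS

/-- The bilinear form `∫_S p q` on polynomials, for compact `S`. -/
def compactForm {n : ℕ} (S : Set (Pt n)) (hS : IsCompact S) :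
    MvPolynomial (Fin n) ℝ →ₗ[ℝ] MvPolynomial (Fin n) ℝ →ₗ[ℝ] ℝ :=
  LinearMap.mk₂ ℝ (fun p q => ∫ x in S, evalAt x (p * q))
    (by
      intro p q r
      rw [← integral_add (integrableOn_evalAt hS _) (integrableOn_evalAt hS _)]
      simp [evalAt, add_mul])
    (by
      intro c p q
      rw [smul_eq_mul, ← integral_const_mul]
      simp [evalAt, MvPolynomial.smul_eval])
    (by
      intro p q r
      rw [← integral_add (integrableOn_evalAt hS _) (integrableOn_evalAt hS _)]
      simp [evalAt, mul_add])
    (by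
      intro c p q
      rw [smul_eq_mul, ← integral_const_mul]
      simp [evalAt, MvPolynomial.smul_eval])

theorem evalAt_mul_self_nonneg {n : ℕ} (x : Pt n) (p : MvPolynomial (Fin n) ℝ) :
    0 ≤ evalAt x (p * p) := by
  rw [evalAt, map_mul]
  exact mul_self_nonneg _

/-- A polynomial that vanishes on a ball is zero. -/
theorem eq_zero_of_evalAt_eq_zero_on_ball {n : ℕ} {c : Pt n} {r : ℝ} (hr : 0 < r)
    {p : MvPolynomial (Fin n) ℝ} (hp : ∀ x ∈ Metric.ball c r, evalAt x p = 0) : p = 0 := by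
  have hopen : IsOpen ((fun y : Fin n → ℝ => (WithLp.toLp 2 y : Pt n)) ⁻¹' Metric.ball c r) :=
    Metric.isOpen_ball.preimage (by fun_prop)
  -- `MvPolynomial.funext_set` needs a product of infinite sets, so a sup-norm ball is placed inside
  -- the Euclidean one.
  obtain ⟨δ, hδ, hsub⟩ := Metric.isOpen_iff.1 hopen (fun i => c i) (by simpa using hr)
  refine MvPolynomial.funext_set (fun i => Metric.ball (c i) δ)
    (fun i => by rw [Real.ball_eq_Ioo]; exact Set.Ioo_infinite (by linarith)) fun x hx => ?_
  rw [map_zero]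
  refine hp (WithLp.toLp 2 x) (hsub ?_)
  rw [Metric.mem_ball, dist_pi_lt_iff hδ]
  exact fun i => hx i (Set.mem_univ i)

/-- The square is continuous with zero integral over the ball, hence vanishes on its interior, which
determines a polynomial. -/
theorem eq_zero_of_setIntegral_sq_le_zero {n : ℕ} {S : Set (Pt n)} (hS : IsCompact S) {c : Pt n}
    {r : ℝ} (hr : 0 < r) (hsub : Metric.closedBall c r ⊆ S) {p : MvPolynomial (Fin n) ℝ}
    (hp : ∫ x in S, evalAt x (p * p) ≤ 0) : p = 0 := by
  have h0 : ∫ x in Metric.ball c r, evalAt x (p * p) = 0 := by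
    refine le_antisymm (le_trans ?_ hp) (integral_nonneg fun x => evalAt_mul_self_nonneg x p)
    exact setIntegral_mono_set (integrableOn_evalAt hS _)
      (Filter.Eventually.of_forall fun x => evalAt_mul_self_nonneg x p)
      (Filter.Eventually.of_forall (Metric.ball_subset_closedBall.trans hsub))
  have h1 : Set.EqOn (fun x => evalAt x (p * p)) 0 (Metric.ball c r) := by
    rw [setIntegral_eq_zero_iff_of_nonneg_ae
      (Filter.Eventually.of_forall fun x => evalAt_mul_self_nonneg x p)
      ((integrableOn_evalAt hS _).mono_set (Metric.ball_subset_closedBall.trans hsub))] at h0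
    exact Measure.eqOn_open_of_ae_eq h0 Metric.isOpen_ball (continuous_evalAt _).continuousOn
      continuousOn_const
  refine eq_zero_of_evalAt_eq_zero_on_ball (c := c) hr fun x hx => ?_
  have := h1 hx
  simpa [evalAt] using this

/-! ### Norm equivalence and scaling to reference balls -/

/-- On a finite-dimensional space, a quadratic form is bounded by any definite one. -/
theorem exists_quadratic_le {V : Type*} [AddCommGroup V] [Module ℝ V] [Module.Finite ℝ V]
    (B₁ B₂ : V →ₗ[ℝ] V →ₗ[ℝ] ℝ) (h₂ : ∀ v, v ≠ 0 → 0 < B₂ v v) :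
    ∃ C : ℝ, 0 < C ∧ ∀ v, B₁ v v ≤ C * B₂ v v := by
  let e := (Module.finBasis ℝ V).equivFun.symm
  have hcont : ∀ B : V →ₗ[ℝ] V →ₗ[ℝ] ℝ, Continuous fun x => B (e x) (e x) := by
    intro B
    have h : ∀ x, B (e x) (e x) = ∑ i, ∑ j, x i * (x j * B (Module.finBasis ℝ V i)
        (Module.finBasis ℝ V j)) := by
      intro x
      simp [e, Module.Basis.equivFun_symm_apply, LinearMap.sum_apply, Finset.mul_sum]
      rw [Finset.sum_comm]
      exact Finset.sum_congr rfl fun i _ => Finset.sum_congr rfl fun j _ => mul_left_comm _ _ _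
    simp only [h]
    fun_prop
  have hpos : ∀ x ∈ Metric.sphere (0 : Fin (Module.finrank ℝ V) → ℝ) 1, 0 < B₂ (e x) (e x) := by
    intro x hx
    refine h₂ _ fun h => ?_
    rw [LinearEquiv.map_eq_zero_iff] at h
    simp [h] at hx
  have hq : ContinuousOn (fun x => B₁ (e x) (e x) / B₂ (e x) (e x))
      (Metric.sphere (0 : Fin (Module.finrank ℝ V) → ℝ) 1) :=
    (hcont B₁).continuousOn.div (hcont B₂).continuousOn fun x hx => (hpos x hx).ne'
  obtain ⟨C, hC⟩ := ((isCompact_sphere _ _).image_of_continuousOn hq).bddAbove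
  -- The bound `C` on the unit sphere need not be positive; other vectors follow by homogeneity of
  -- degree two.
  refine ⟨max C 1, by positivity, fun v => ?_⟩
  rcases eq_or_ne v 0 with rfl | hv
  · simp
  set x := e.symm v with hx
  have hx0 : x ≠ 0 := by simpa [hx] using hv
  have hn : ‖x‖ ≠ 0 := norm_ne_zero_iff.2 hx0
  have hs : ‖x‖⁻¹ • x ∈ Metric.sphere (0 : Fin (Module.finrank ℝ V) → ℝ) 1 := by
    rw [mem_sphere_zero_iff_norm, norm_smul, norm_inv, norm_norm, inv_mul_cancel₀ hn]
  have h1 := (hC ⟨_, hs, rfl⟩).trans (le_max_left C 1)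
  rw [div_le_iff₀ (hpos _ hs)] at h1
  have hev : e x = v := by simp [hx]
  simp only [map_smul, LinearMap.smul_apply, smul_eq_mul, hev] at h1
  have h2 : 0 < ‖x‖⁻¹ * ‖x‖⁻¹ := by positivity
  refine le_of_mul_le_mul_left ?_ h2
  linarith

/-- Affine change of variables on balls. -/
theorem setIntegral_closedBall_comp {n : ℕ} (f : Pt n → ℝ) (c : Pt n) {h : ℝ} (hh : 0 < h)
    (r : ℝ) :
    ∫ x in Metric.closedBall c (h * r), f x =
      h ^ n * ∫ x in Metric.closedBall (0 : Pt n) r, f (c + h • x) := by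
  have h1 := Measure.setIntegral_comp_smul_of_pos (volume : Measure (Pt n)) (fun x => f (c + x))
    (Metric.closedBall (0 : Pt n) r) hh
  rw [smul_closedBall' hh.ne', smul_zero, Real.norm_of_nonneg hh.le, finrank_euclideanSpace_fin,
    smul_eq_mul] at h1
  rw [h1, mul_inv_cancel_left₀ (by positivity)]
  have h2 := (measurePreserving_add_left (volume : Measure (Pt n)) c).setIntegral_preimage_emb
    (measurableEmbedding_addLeft c) f (Metric.closedBall c (h * r))
  rw [← h2]
  congr 2
  ext x
  simp [dist_eq_norm]

/-- On shape-regular cells, polynomials have antiderivatives whose norm gains a factor `h`. -/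
theorem exists_antideriv_bound (n k : ℕ) {δ : ℝ} (hδ : 0 < δ) :
    ∃ C : ℝ, 0 < C ∧ ∀ (K : Finset (Pt n)) (c : Pt n) (h : ℝ), 0 < h →
      Metric.closedBall c (h * δ) ⊆ hull K → hull K ⊆ Metric.closedBall c h →
      ∀ (i : Fin n), ∀ p ∈ MvPolynomial.restrictTotalDegree (Fin n) ℝ k,
        ∃ q ∈ MvPolynomial.restrictTotalDegree (Fin n) ℝ (k + 1),
          MvPolynomial.pderiv i q = p ∧ cellInt K (q * q) ≤ C * h ^ 2 * cellInt K (p * p) := by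
  -- After the map `x ↦ c + h x` the cell lies between the balls of radii `δ` and `1` about the
  -- origin. Comparing norms on these two fixed balls, rather than on a reference cell, frees the
  -- constant from the shape of `K`.
  let ι := (MvPolynomial.restrictTotalDegree (Fin n) ℝ k).subtype
  let B₁ := fun i : Fin n =>
    (compactForm (Metric.closedBall (0 : Pt n) 1) (isCompact_closedBall _ _)).compl₁₂
      (antideriv i ∘ₗ ι) (antideriv i ∘ₗ ι)
  let B₂ := (compactForm (Metric.closedBall (0 : Pt n) δ) (isCompact_closedBall _ _)).compl₁₂ ι ι
  have hB₂ : ∀ v, v ≠ 0 → 0 < B₂ v v := by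
    intro v hv
    by_contra hle
    exact hv (Subtype.ext (eq_zero_of_setIntegral_sq_le_zero (isCompact_closedBall _ _) hδ
      subset_rfl (not_lt.1 hle)))
  choose C hC0 hC using fun i => exists_quadratic_le (B₁ i) B₂ hB₂
  refine ⟨1 + ∑ i, C i, add_pos_of_pos_of_nonneg one_pos (Finset.sum_nonneg fun i _ => (hC0 i).le),
    fun K c h hh hin hout i p hp => ?_⟩
  have hp' : affineSubst c h p ∈ MvPolynomial.restrictTotalDegree (Fin n) ℝ k := by
    rw [MvPolynomial.mem_restrictTotalDegree] at hp ⊢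
    exact (totalDegree_affineSubst_le c h p).trans hp
  -- Pull back, integrate, push forward: the chain rule costs `h⁻¹`, which the prefactor `h`
  -- repairs. That prefactor is the gain of `h²` in the squared norm; the Jacobians `h ^ n` on the
  -- two sides agree.
  refine ⟨h • affineSubst (-(h⁻¹ • c)) h⁻¹ (antideriv i (affineSubst c h p)), ?_, ?_, ?_⟩
  · refine Submodule.smul_mem _ _ ?_
    rw [MvPolynomial.mem_restrictTotalDegree] at hp' ⊢
    exact (totalDegree_affineSubst_le _ _ _).trans (totalDegree_antideriv_le i hp')
  · rw [Derivation.map_smul, pderiv_affineSubst, pderiv_antideriv, affineSubst_affineSubst_inv c hh.ne',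
      ← MvPolynomial.smul_eq_C_mul, smul_smul, mul_inv_cancel₀ hh.ne', one_smul]
  · set q := h • affineSubst (-(h⁻¹ • c)) h⁻¹ (antideriv i (affineSubst c h p)) with hq
    have hq' : ∀ x, evalAt (c + h • x) (q * q) =
        h ^ 2 * evalAt x (antideriv i (affineSubst c h p) * antideriv i (affineSubst c h p)) := by
      intro x
      have h1 := evalAt_affineSubst (-(h⁻¹ • c)) h⁻¹ (antideriv i (affineSubst c h p)) (c + h • x)
      rw [smul_add, smul_smul, inv_mul_cancel₀ hh.ne', one_smul, neg_add_cancel_left] at h1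
      rw [hq]
      simp only [evalAt, map_mul, MvPolynomial.smul_eval] at h1 ⊢
      rw [h1]
      ring
    have hp'' : ∀ x, evalAt (c + h • x) (p * p) =
        evalAt x (affineSubst c h p * affineSubst c h p) := by
      intro x
      rw [← map_mul, evalAt_affineSubst]
    have up : cellInt K (q * q) ≤ ∫ x in Metric.closedBall c (h * 1), evalAt x (q * q) := by
      rw [mul_one]
      exact setIntegral_mono_set (integrableOn_evalAt (isCompact_closedBall _ _) _)
        (Filter.Eventually.of_forall fun x => evalAt_mul_self_nonneg x q)
        (Filter.Eventually.of_forall hout)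
    have lo : ∫ x in Metric.closedBall c (h * δ), evalAt x (p * p) ≤ cellInt K (p * p) :=
      setIntegral_mono_set (integrableOn_evalAt (isCompact_hull K) _)
        (Filter.Eventually.of_forall fun x => evalAt_mul_self_nonneg x p)
        (Filter.Eventually.of_forall hin)
    rw [setIntegral_closedBall_comp _ c hh] at up lo
    simp only [hq', hp''] at up lo
    rw [integral_const_mul] at up
    have key : ∫ x in Metric.closedBall (0 : Pt n) 1,
        evalAt x (antideriv i (affineSubst c h p) * antideriv i (affineSubst c h p)) ≤
        C i * ∫ x in Metric.closedBall (0 : Pt n) δ,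
          evalAt x (affineSubst c h p * affineSubst c h p) := hC i ⟨_, hp'⟩
    have hCi : C i ≤ 1 + ∑ i, C i :=
      (Finset.single_le_sum (fun j _ => (hC0 j).le) (Finset.mem_univ i)).trans (by linarith)
    have h0 : 0 ≤ cellInt K (p * p) := integral_nonneg fun x => evalAt_mul_self_nonneg x p
    calc cellInt K (q * q)
        ≤ h ^ n * (h ^ 2 * (C i * ∫ x in Metric.closedBall (0 : Pt n) δ,
          evalAt x (affineSubst c h p * affineSubst c h p))) := by
          refine up.trans ?_
          gcongr
      _ = C i * h ^ 2 * (h ^ n * ∫ x in Metric.closedBall (0 : Pt n) δ,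
          evalAt x (affineSubst c h p * affineSubst c h p)) := by ring
      _ ≤ C i * h ^ 2 * cellInt K (p * p) := by
          have := hC0 i
          gcongr
      _ ≤ (1 + ∑ i, C i) * h ^ 2 * cellInt K (p * p) := by gcongr

/-! ### Shape regularity of the split cells -/

theorem subset_hull {n : ℕ} (K : Finset (Pt n)) : (K : Set (Pt n)) ⊆ hull K :=
  subset_convexHull ℝ _

theorem barycentre_mem_hull {n : ℕ} {s : Finset (Pt n)} (hs : s.Nonempty) :
    barycentre s ∈ hull s := by
  have h0 : (s.card : ℝ) ≠ 0 := by exact_mod_cast hs.card_ne_zero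
  rw [barycentre, Finset.smul_sum]
  refine (convex_convexHull ℝ (s : Set (Pt n))).sum_mem (fun _ _ => by positivity) ?_
    fun v hv => subset_hull s hv
  rw [Finset.sum_const, nsmul_eq_mul, mul_inv_cancel₀ h0]

open scoped Classical in
theorem hull_split_subset {n : ℕ} {s : Finset (Pt n)} (hs : s.Nonempty) (x : Pt n) :
    hull (insert (barycentre s) (s.erase x)) ⊆ hull s := by
  refine convexHull_min (fun v hv => ?_) (convex_convexHull ℝ _)
  rcases Finset.mem_insert.1 (Finset.mem_coe.1 hv) with rfl | hv
  · exact barycentre_mem_hull hs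
  · exact subset_hull s (Finset.mem_of_mem_erase hv)

open scoped Classical in
/-- A ball inscribed in a simplex, scaled by the factor `N⁻²` where `N` is the number of vertices,
fits into each part of the barycentric splitting. -/
theorem closedBall_subset_hull_split {n : ℕ} {s : Finset (Pt n)} (hs : 2 ≤ s.card) {x : Pt n}
    (hx : x ∈ s) {c : Pt n} {r : ℝ} (hr : 0 ≤ r) (hc : Metric.closedBall c r ⊆ hull s) :
    ∃ c', Metric.closedBall c' (r / (s.card : ℝ) ^ 2) ⊆
      hull (insert (barycentre s) (s.erase x)) := by
  set N : ℝ := (s.card : ℝ) with hN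
  have hN2 : (2 : ℝ) ≤ N := by rw [hN]; exact_mod_cast hs
  have hN0 : N ≠ 0 := by positivity
  let z : Pt n → Pt n := fun v => if v = x then barycentre s else v
  have hz : ∀ v ∈ s, z v ∈ hull (insert (barycentre s) (s.erase x)) := by
    intro v hv
    refine subset_hull _ (Finset.mem_coe.2 ?_)
    by_cases hvx : v = x
    · simp [z, hvx]
    · simp [z, hvx, hv]
  refine ⟨N⁻¹ • ∑ v ∈ s, z v, fun y' hy' => ?_⟩
  set c' := N⁻¹ • ∑ v ∈ s, z v with hc'
  have hy : c + N ^ 2 • (y' - c') ∈ hull s := by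
    refine hc ?_
    rw [mem_closedBall_iff_norm] at hy' ⊢
    rw [add_sub_cancel_left, norm_smul, Real.norm_of_nonneg (by positivity)]
    rw [le_div_iff₀ (by positivity)] at hy'
    linarith
  obtain ⟨a, ha0, ha1, ha⟩ := Finset.mem_convexHull'.1 hy
  obtain ⟨e, he0, he1, he⟩ := Finset.mem_convexHull'.1 (hc (Metric.mem_closedBall_self hr))
  have bound : ∀ {f : Pt n → ℝ}, (∀ v ∈ s, 0 ≤ f v) → ∑ v ∈ s, f v = 1 → ∀ v ∈ s, f v ≤ 1 :=
    fun hf0 hf1 v hv => (Finset.single_le_sum hf0 hv).trans hf1.le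
  -- Magnifying the offset from the new centre by `N²` gives a point of the old ball; `d` is the
  -- difference of its barycentric coordinates and those of `c`, so it sums to zero and lies in
  -- `[-1, 1]`.
  let d : Pt n → ℝ := fun v => a v - e v
  have hd1 : ∀ v ∈ s, -1 ≤ d v ∧ d v ≤ 1 := fun v hv =>
    ⟨by have := ha0 v hv; have := bound he0 he1 v hv; simp only [d]; linarith,
      by have := he0 v hv; have := bound ha0 ha1 v hv; simp only [d]; linarith⟩
  have hd0 : ∑ v ∈ s, d v = 0 := by simp [d, Finset.sum_sub_distrib, ha1, he1]
  have hds : ∑ v ∈ s, d v • v = N ^ 2 • (y' - c') := by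
    simp only [d, sub_smul, Finset.sum_sub_distrib, ha, he]
    abel
  -- Coordinates of `y'` in the split cell: substitute `x = N b - ∑_{v ≠ x} v`, with `b` the
  -- barycentre, into `∑ d v • v`. They are nonnegative since `N⁻¹ - 2 N⁻² ≥ 0` for `v ≠ x` and `N⁻¹
  -- + N⁻¹ d x ≥ 0` for the barycentre; this is where the factor `N²` and `2 ≤ N` come from.
  let W : Pt n → ℝ := fun v =>
    N⁻¹ + (N ^ 2)⁻¹ * (d v - d x) + if v = x then N⁻¹ * d x else 0
  have hb : N • barycentre s = ∑ v ∈ s, v := by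
    rw [barycentre, smul_smul, ← hN, mul_inv_cancel₀ hN0, one_smul]
  have hsum : ∑ v ∈ s, W v • z v = y' := by
    have h1 : ∑ v ∈ s, (d v - d x) • z v = ∑ v ∈ s, (d v - d x) • v := by
      refine Finset.sum_congr rfl fun v _ => ?_
      by_cases hvx : v = x <;> simp [z, hvx]
    have h2 : ∑ v ∈ s, (if v = x then N⁻¹ * d x else 0) • z v = (N⁻¹ * d x) • barycentre s := by
      rw [Finset.sum_eq_single_of_mem x hx fun v _ hvx => by rw [if_neg hvx, zero_smul]]
      simp [z]
    simp only [W, add_smul, Finset.sum_add_distrib, mul_smul ((N ^ 2)⁻¹), ← Finset.smul_sum, h1, h2]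
    rw [← hc']
    simp only [sub_smul, Finset.sum_sub_distrib, hds]
    rw [← Finset.smul_sum, ← hb, smul_sub, smul_smul, smul_smul, smul_smul, inv_mul_cancel₀ (by positivity), one_smul]
    have h3 : (N ^ 2)⁻¹ * d x * N = N⁻¹ * d x := by field_simp
    rw [h3]
    abel
  rw [← hsum]
  refine (convex_convexHull ℝ _).sum_mem (fun v hv => ?_) ?_ hz
  · have hNN : N⁻¹ = (N ^ 2)⁻¹ * N := by field_simp
    have hp : 0 < (N ^ 2)⁻¹ := by positivity
    by_cases hvx : v = x
    · have : 0 < N⁻¹ := by positivity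
      simp only [W, hvx, sub_self, mul_zero, add_zero, if_true]
      nlinarith [hd1 x hx]
    · simp only [W, if_neg hvx, add_zero]
      rw [hNN]
      nlinarith [hd1 x hx, hd1 v hv]
  · simp only [W, Finset.sum_add_distrib, ← Finset.mul_sum, Finset.sum_sub_distrib, hd0,
      Finset.sum_const, nsmul_eq_mul, ← hN, Finset.sum_ite_eq', hx, if_true]
    field_simp
    ring

/-- All elements of a split quasi-uniform mesh contain a ball of radius proportional to the mesh
size, and lie in the concentric ball whose radius is the mesh size. -/
theorem SplitMesh.QuasiUniform.exists_closedBall {n : ℕ} (hn : 0 < n) {D : MixedDomain n}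
    {T : SplitMesh D} {κ : ℝ} (hκ : 0 < κ) (hT : T.QuasiUniform κ) (K : T.cells) :
    0 < T.meshSize ∧ ∃ c, Metric.closedBall c (T.meshSize * (κ / ((n : ℝ) + 1) ^ 2)) ⊆ hull K.1 ∧
      hull K.1 ⊆ Metric.closedBall c T.meshSize := by
  classical
  have hbdd : ∀ s : Finset (Pt n), Bornology.IsBounded (hull s) := fun s =>
    (isCompact_hull s).isBounded
  have hnonempty : ∀ s ∈ T.macro_, s.Nonempty := fun s hs =>
    Finset.card_pos.1 (by rw [T.card_eq s hs]; omega)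
  have hsplit : ∀ K ∈ T.cells, ∃ s ∈ T.macro_, ∃ x ∈ s,
      K = insert (barycentre s) (s.erase x) := by
    intro K hK
    obtain ⟨s, hs, hK⟩ := Finset.mem_biUnion.1 hK
    obtain ⟨x, hx, rfl⟩ := Finset.mem_image.1 hK
    exact ⟨s, hs, x, hx, by congr!⟩
  have hdiam : ∀ K' : T.cells, Metric.diam (hull K'.1) ≤ T.meshSize := fun K' =>
    le_ciSup (f := fun K : T.cells => Metric.diam (hull K.1)) (Set.finite_range _).bddAbove K'
  obtain ⟨s, hs, x, hx, hKs⟩ := hsplit K.1 K.2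
  have hcard : (s.card : ℝ) = (n : ℝ) + 1 := by rw [T.card_eq s hs]; push_cast; rfl
  have inner : ∀ t ∈ T.macro_, ∃ c,
      Metric.closedBall c (κ * Metric.diam (hull t) / ((n : ℝ) + 1) ^ 2) ⊆ hull K.1 := by
    intro t ht
    obtain ⟨c, hc⟩ := hT s hs t ht
    rw [hKs, ← hcard]
    exact closedBall_subset_hull_split (by rw [T.card_eq s hs]; omega) hx
      (mul_nonneg hκ.le Metric.diam_nonneg) hc
  have hpos : 0 < T.meshSize := by
    obtain ⟨a, ha, b, hb, hab⟩ := Finset.one_lt_card.1 (by rw [T.card_eq s hs]; omega : 1 < s.card)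
    have hd : 0 < Metric.diam (hull s) := (dist_pos.2 hab).trans_le
      (Metric.dist_le_diam_of_mem (hbdd s) (subset_hull s ha) (subset_hull s hb))
    obtain ⟨c, hc⟩ := inner s hs
    set r := κ * Metric.diam (hull s) / ((n : ℝ) + 1) ^ 2 with hr
    have hr0 : 0 < r := by positivity
    refine lt_of_lt_of_le ?_ ((Metric.dist_le_diam_of_mem (hbdd K.1)
      (hc (Metric.mem_closedBall_self hr0.le))
      (hc (?_ : c + EuclideanSpace.single (⟨0, hn⟩ : Fin n) r ∈ _))).trans (hdiam K))
    · simpa using hr0.ne'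
    · simp [abs_of_pos hr0]
  have : Nonempty T.cells := ⟨K⟩
  -- The macro-simplex `t` around a cell of largest diameter has diameter at least `h`;
  -- quasi-uniformity, comparing the parent `s` of `K` with `t`, turns this into a radius
  -- proportional to `h`.
  obtain ⟨K', hK'⟩ := exists_eq_ciSup_of_finite (f := fun K : T.cells => Metric.diam (hull K.1))
  obtain ⟨t, ht, x', -, hKt⟩ := hsplit K'.1 K'.2
  have hle : T.meshSize ≤ Metric.diam (hull t) := by
    refine hK'.ge.trans ?_
    refine Metric.diam_mono ?_ (hbdd t)
    rw [hKt]
    exact hull_split_subset (hnonempty t ht) x'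
  obtain ⟨c, hc⟩ := inner t ht
  refine ⟨hpos, c, (Metric.closedBall_subset_closedBall ?_).trans hc, fun y hy => ?_⟩
  · rw [mul_div_assoc', mul_comm κ]
    gcongr
  · rw [Metric.mem_closedBall]
    refine (Metric.dist_le_diam_of_mem (hbdd K.1) hy (hc (Metric.mem_closedBall_self ?_))).trans
      (hdiam K)
    have := Metric.diam_nonneg (s := hull t)
    positivity

section Forms

variable {n k : ℕ} {D : MixedDomain n} {T : SplitMesh D}

/-! ### The elementwise forms -/

theorem matForm_apply (τ υ : BrokenMat T) :
    matForm T τ υ = ∑ K, cellInt K.1 (∑ i, ∑ j, τ K i j * υ K i j) := rfl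

theorem vecForm_apply (u w : BrokenVec T) :
    vecForm T u w = ∑ K, cellInt K.1 (∑ i, u K i * w K i) := rfl

theorem matForm_comm (τ υ : BrokenMat T) : matForm T τ υ = matForm T υ τ := by
  simp only [matForm_apply, mul_comm]

theorem vecForm_comm (u w : BrokenVec T) : vecForm T u w = vecForm T w u := by
  simp only [vecForm_apply, mul_comm]

theorem cellInt_mono {K : Finset (Pt n)} {p q : MvPolynomial (Fin n) ℝ}
    (h : ∀ x, evalAt x p ≤ evalAt x q) : cellInt K p ≤ cellInt K q :=
  setIntegral_mono (integrableOn_evalAt (isCompact_hull K) _)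
    (integrableOn_evalAt (isCompact_hull K) _) h

theorem cellInt_nonneg {K : Finset (Pt n)} {p : MvPolynomial (Fin n) ℝ}
    (h : ∀ x, 0 ≤ evalAt x p) : 0 ≤ cellInt K p :=
  integral_nonneg h

theorem matForm_self (τ : BrokenMat T) :
    matForm T τ τ = ∑ K, ∑ i, ∑ j, cellInt K.1 (τ K i j * τ K i j) := by
  simp only [matForm_apply, map_sum]

theorem vecForm_self (u : BrokenVec T) :
    vecForm T u u = ∑ K, ∑ i, cellInt K.1 (u K i * u K i) := by
  simp only [vecForm_apply, map_sum]

theorem vecForm_self_nonneg (u : BrokenVec T) : 0 ≤ vecForm T u u := by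
  rw [vecForm_self]
  exact Finset.sum_nonneg fun K _ => Finset.sum_nonneg fun i _ =>
    cellInt_nonneg fun x => evalAt_mul_self_nonneg x _

/-- Every element contains a ball of positive radius. -/
def HasInscribedBalls (T : SplitMesh D) : Prop :=
  ∀ K : T.cells, ∃ (c : Pt n) (r : ℝ), 0 < r ∧ Metric.closedBall c r ⊆ hull K.1

theorem HasInscribedBalls.eq_zero_of_cellInt (hT : HasInscribedBalls T) {K : T.cells}
    {p : MvPolynomial (Fin n) ℝ} (hp : cellInt K.1 (p * p) ≤ 0) : p = 0 := by
  obtain ⟨c, r, hr, hc⟩ := hT K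
  exact eq_zero_of_setIntegral_sq_le_zero (isCompact_hull _) hr hc hp

theorem HasInscribedBalls.eq_zero_of_vecForm (hT : HasInscribedBalls T) {u : BrokenVec T}
    (hu : vecForm T u u ≤ 0) : u = 0 := by
  funext K i
  refine hT.eq_zero_of_cellInt (K := K) (le_trans ?_ hu)
  rw [vecForm_self]
  have h0 : ∀ K : T.cells, ∀ i, 0 ≤ cellInt K.1 (u K i * u K i) := fun K i =>
    cellInt_nonneg fun x => evalAt_mul_self_nonneg x _
  exact (Finset.single_le_sum (f := fun i => cellInt K.1 (u K i * u K i)) (fun i _ => h0 K i)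
    (Finset.mem_univ i)).trans (Finset.single_le_sum
      (f := fun K : T.cells => ∑ i, cellInt K.1 (u K i * u K i))
      (fun K _ => Finset.sum_nonneg fun i _ => h0 K i) (Finset.mem_univ K))

theorem HasInscribedBalls.eq_zero_of_matForm (hT : HasInscribedBalls T) {τ : BrokenMat T}
    (hτ : matForm T τ τ ≤ 0) : τ = 0 := by
  funext K i j
  refine hT.eq_zero_of_cellInt (K := K) (le_trans ?_ hτ)
  rw [matForm_self]
  have h0 : ∀ K : T.cells, ∀ i j, 0 ≤ cellInt K.1 (τ K i j * τ K i j) := fun K i j =>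
    cellInt_nonneg fun x => evalAt_mul_self_nonneg x _
  exact (Finset.single_le_sum (f := fun j => cellInt K.1 (τ K i j * τ K i j)) (fun j _ => h0 K i j)
    (Finset.mem_univ j)).trans ((Finset.single_le_sum
      (f := fun i => ∑ j, cellInt K.1 (τ K i j * τ K i j))
      (fun i _ => Finset.sum_nonneg fun j _ => h0 K i j) (Finset.mem_univ i)).trans
      (Finset.single_le_sum (f := fun K : T.cells => ∑ i, ∑ j, cellInt K.1 (τ K i j * τ K i j))
      (fun K _ => Finset.sum_nonneg fun i _ => Finset.sum_nonneg fun j _ => h0 K i j)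
      (Finset.mem_univ K)))

/-! ### The compliance tensor -/

/-- The value of a matrix of polynomials at a point. -/
def evalMat (x : Pt n) (τ : Matrix (Fin n) (Fin n) (MvPolynomial (Fin n) ℝ)) :
    Matrix (Fin n) (Fin n) ℝ := fun i j => evalAt x (τ i j)

theorem Lame.compliance_apply (L : Lame T) (K : T.cells) {R : Type} [CommRing R] [Algebra ℝ R]
    (τ : Matrix (Fin n) (Fin n) R) (i j : Fin n) :
    L.compliance K τ i j = (1 / (2 * L.mu K)) • τ i j +
      (1 / (n * (n * L.lam K + 2 * L.mu K)) - 1 / (2 * L.mu K) * (1 / (n : ℝ))) •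
        (τ.trace * (1 : Matrix (Fin n) (Fin n) R) i j) := by
  simp only [Lame.compliance, Matrix.add_apply, Matrix.smul_apply, Matrix.sub_apply, smul_sub,
    sub_smul, smul_eq_mul, smul_smul]
  abel

theorem evalMat_compliance (L : Lame T) (K : T.cells) (x : Pt n)
    (τ : Matrix (Fin n) (Fin n) (MvPolynomial (Fin n) ℝ)) :
    evalMat x (L.compliance K τ) = L.compliance K (evalMat x τ) := by
  ext i j
  have htr : (evalMat x τ).trace = evalAt x τ.trace := by
    simp [Matrix.trace, evalMat, evalAt]
  rw [Lame.compliance_apply, evalMat, Lame.compliance_apply, htr]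
  rcases eq_or_ne i j with rfl | hij
  · simp [evalAt, evalMat, MvPolynomial.smul_eval]
  · simp [evalAt, evalMat, MvPolynomial.smul_eval, Matrix.one_apply_ne hij]

/-- Separating the full product from the trace product makes the symmetry of `𝒜` visible and reduces
its coercivity to an estimate of the trace. -/
theorem Lame.compliance_inner (L : Lame T) (K : T.cells) {R : Type} [CommRing R] [Algebra ℝ R]
    (τ υ : Matrix (Fin n) (Fin n) R) :
    ∑ i, ∑ j, L.compliance K τ i j * υ i j = (1 / (2 * L.mu K)) • (∑ i, ∑ j, τ i j * υ i j) +
      (1 / (n * (n * L.lam K + 2 * L.mu K)) - 1 / (2 * L.mu K) * (1 / (n : ℝ))) •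
        (τ.trace * υ.trace) := by
  simp only [Lame.compliance_apply, add_mul, Finset.sum_add_distrib, smul_mul_assoc,
    ← Finset.smul_sum]
  congr 2
  simp [Matrix.one_apply, Matrix.trace, Finset.mul_sum]

theorem matForm_compliance_comm (L : Lame T) (τ υ : BrokenMat T) :
    matForm T (L.complianceMap τ) υ = matForm T (L.complianceMap υ) τ := by
  simp only [matForm_apply]
  refine Finset.sum_congr rfl fun K _ => congrArg _ ?_
  change ∑ i, ∑ j, L.compliance K (τ K) i j * υ K i j =
    ∑ i, ∑ j, L.compliance K (υ K) i j * τ K i j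
  rw [L.compliance_inner, L.compliance_inner]
  simp only [mul_comm]

/-- Pointwise coercivity of the compliance tensor. -/
theorem Lame.exists_coercive (hn : 0 < n) (L : Lame T) (K : T.cells) :
    ∃ α : ℝ, 0 < α ∧ ∀ τ : Matrix (Fin n) (Fin n) ℝ,
      α * ∑ i, ∑ j, τ i j * τ i j ≤ ∑ i, ∑ j, L.compliance K τ i j * τ i j := by
  have hn' : (0 : ℝ) < n := by exact_mod_cast hn
  set a := 1 / (2 * L.mu K) with ha
  set b := 1 / (n * L.lam K + 2 * L.mu K) with hb
  have ha0 : 0 < a := by have := L.mu_pos K; positivity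
  have hb0 : 0 < b := by have := L.bulk_pos K; positivity
  refine ⟨min a b, lt_min ha0 hb0, fun τ => ?_⟩
  -- Cauchy–Schwarz on the diagonal, that is, `|τᴰ|² = |τ|² - (tr τ)²/n ≥ 0`. The energy is `a |τᴰ|²
  -- + b (tr τ)²/n`, hence the constant `min a b`.
  have htr : τ.trace * τ.trace ≤ n * ∑ i, ∑ j, τ i j * τ i j := by
    have h1 : τ.trace ^ 2 ≤ n * ∑ i, τ i i ^ 2 := by
      simpa [Matrix.trace] using
        sq_sum_le_card_mul_sum_sq (s := Finset.univ) (f := fun i => τ i i)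
    have h2 : ∑ i, τ i i ^ 2 ≤ ∑ i, ∑ j, τ i j * τ i j := Finset.sum_le_sum fun i _ => by
      rw [sq]
      exact Finset.single_le_sum (f := fun j => τ i j * τ i j) (fun j _ => mul_self_nonneg _)
        (Finset.mem_univ i)
    nlinarith
  have hsplit : (1 : ℝ) / (n * (n * L.lam K + 2 * L.mu K)) = b / n := by
    rw [hb, div_div, mul_comm]
  have htr' : τ.trace * τ.trace / n ≤ ∑ i, ∑ j, τ i j * τ i j := by
    rw [div_le_iff₀ hn']
    linarith
  have htr0 : 0 ≤ τ.trace * τ.trace / n := div_nonneg (mul_self_nonneg _) hn'.le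
  have h1 := mul_le_mul_of_nonneg_right (min_le_left a b) (sub_nonneg.2 htr')
  have h2 := mul_le_mul_of_nonneg_right (min_le_right a b) htr0
  rw [L.compliance_inner, hsplit]
  simp only [smul_eq_mul]
  calc min a b * ∑ i, ∑ j, τ i j * τ i j
      = min a b * (∑ i, ∑ j, τ i j * τ i j - τ.trace * τ.trace / n) +
          min a b * (τ.trace * τ.trace / n) := by ring
    _ ≤ a * (∑ i, ∑ j, τ i j * τ i j - τ.trace * τ.trace / n) +
          b * (τ.trace * τ.trace / n) := add_le_add h1 h2
    _ = _ := by ring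

theorem evalAt_inner (x : Pt n) (τ υ : Matrix (Fin n) (Fin n) (MvPolynomial (Fin n) ℝ)) :
    evalAt x (∑ i, ∑ j, τ i j * υ i j) = ∑ i, ∑ j, evalMat x τ i j * evalMat x υ i j := by
  simp [evalAt, evalMat]

theorem evalAt_compliance_inner (L : Lame T) (K : T.cells) (x : Pt n)
    (τ : Matrix (Fin n) (Fin n) (MvPolynomial (Fin n) ℝ)) :
    evalAt x (∑ i, ∑ j, L.compliance K τ i j * τ i j) =
      ∑ i, ∑ j, L.compliance K (evalMat x τ) i j * evalMat x τ i j := by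
  rw [evalAt_inner, evalMat_compliance]

/-- The constant `α` varies with the cell and the Lamé coefficients; it serves only for positivity
and definiteness and never reaches `C⋆`. -/
theorem cellInt_compliance_ge (hn : 0 < n) (L : Lame T) (K : T.cells) :
    ∃ α : ℝ, 0 < α ∧ ∀ τ : Matrix (Fin n) (Fin n) (MvPolynomial (Fin n) ℝ),
      0 ≤ cellInt K.1 (∑ i, ∑ j, τ i j * τ i j) ∧
      α * cellInt K.1 (∑ i, ∑ j, τ i j * τ i j) ≤
        cellInt K.1 (∑ i, ∑ j, L.compliance K τ i j * τ i j) := by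
  obtain ⟨α, hα, h⟩ := L.exists_coercive hn K
  refine ⟨α, hα, fun τ => ⟨cellInt_nonneg fun x => ?_, ?_⟩⟩
  · rw [evalAt_inner]
    exact Finset.sum_nonneg fun i _ => Finset.sum_nonneg fun j _ => mul_self_nonneg _
  · rw [← smul_eq_mul, ← map_smul]
    refine cellInt_mono fun x => ?_
    rw [evalAt_compliance_inner]
    refine le_trans (le_of_eq ?_) (h _)
    rw [← evalAt_inner]
    simp [evalAt, MvPolynomial.smul_eval]

theorem matForm_compliance_self_nonneg (hn : 0 < n) (L : Lame T) (τ : BrokenMat T) :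
    0 ≤ matForm T (L.complianceMap τ) τ := by
  refine Finset.sum_nonneg fun K _ => ?_
  obtain ⟨α, hα, h⟩ := cellInt_compliance_ge hn L K
  exact (mul_nonneg hα.le (h (τ K)).1).trans (h (τ K)).2

theorem HasInscribedBalls.eq_zero_of_compliance (hT : HasInscribedBalls T) (hn : 0 < n)
    (L : Lame T) {τ : BrokenMat T} (hτ : matForm T (L.complianceMap τ) τ = 0) : τ = 0 := by
  choose α hα h using cellInt_compliance_ge hn L
  have hK := (Finset.sum_eq_zero_iff_of_nonneg fun K _ =>
    (mul_nonneg (hα K).le (h K (τ K)).1).trans (h K (τ K)).2).1 hτ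
  refine hT.eq_zero_of_matForm (Finset.sum_nonpos fun K hKmem => ?_)
  have h1 := (h K (τ K)).2.trans (hK K hKmem).le
  exact nonpos_of_mul_nonpos_right h1 (hα K)

/-- The energy of a stress is at most `M` times its squared norm. -/
theorem Lame.BoundedBy.matForm_le {L : Lame T} {M : ℝ} (hM : 0 < M) (hL : L.BoundedBy M)
    (τ : BrokenMat T) : matForm T (L.complianceMap τ) τ ≤ M * matForm T τ τ := by
  rw [matForm_apply, matForm_apply, Finset.mul_sum]
  refine Finset.sum_le_sum fun K _ => ?_
  rw [← smul_eq_mul, ← map_smul]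
  refine cellInt_mono fun x => ?_
  have h0 : evalAt x (M • ∑ i, ∑ j, τ K i j * τ K i j) =
      M * ∑ i, ∑ j, evalMat x (τ K) i j * evalMat x (τ K) i j := by
    rw [← evalAt_inner]
    simp [evalAt, MvPolynomial.smul_eval]
  rw [h0]
  change evalAt x (∑ i, ∑ j, L.compliance K (τ K) i j * τ K i j) ≤ _
  rw [evalAt_compliance_inner]
  have h1 := hL K (evalMat x (τ K))
  set t := evalMat x (τ K)
  -- Young's inequality weighted by `M` replaces Cauchy–Schwarz, so no square roots appear.
  have h2 : 2 * M * ∑ i, ∑ j, L.compliance K t i j * t i j ≤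
      ∑ i, ∑ j, L.compliance K t i j ^ 2 + M ^ 2 * ∑ i, ∑ j, t i j ^ 2 := by
    simp only [Finset.mul_sum, ← Finset.sum_add_distrib]
    refine Finset.sum_le_sum fun i _ => Finset.sum_le_sum fun j _ => ?_
    nlinarith [sq_nonneg (L.compliance K t i j - M * t i j)]
  have h3 : 2 * M * ∑ i, ∑ j, L.compliance K t i j * t i j ≤
      2 * M * (M * ∑ i, ∑ j, t i j ^ 2) := by linarith
  simp only [← sq]
  exact le_of_mul_le_mul_left h3 (by positivity)

/-! ### Right inverse of the divergence -/

/-- Every displacement is the divergence of a diagonal stress, with a bound. -/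
theorem exists_diagonal_divMap_eq {B : ℝ} (hB : ∀ (K : T.cells) (i : Fin n),
      ∀ p ∈ MvPolynomial.restrictTotalDegree (Fin n) ℝ k,
        ∃ q ∈ MvPolynomial.restrictTotalDegree (Fin n) ℝ (k + 1),
          MvPolynomial.pderiv i q = p ∧ cellInt K.1 (q * q) ≤ B * cellInt K.1 (p * p))
    (f : dispSpace T k) :
    ∃ τ : stressSpace T k, divMap T τ = f ∧ (∀ η : rotSpace T k, matForm T η τ = 0) ∧
      matForm T τ τ ≤ B * vecForm T f f := by
  choose q hq hqf hqB using fun (K : T.cells) (i : Fin n) => hB K i (f.1 K i) (f.2 K i)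
  -- With `q K i` an antiderivative of `f K i` in the `i`-th variable, row `i` of the divergence has
  -- one nonzero term. Skew matrices have zero diagonal, which gives weak symmetry.
  refine ⟨⟨fun K => Matrix.diagonal (q K), fun K i j => ?_⟩, ?_, fun η => ?_, ?_⟩
  · change Matrix.diagonal (q K) i j ∈ _
    rcases eq_or_ne i j with rfl | hij
    · rw [Matrix.diagonal_apply_eq]
      exact hq K i
    · rw [Matrix.diagonal_apply_ne _ hij]
      exact Submodule.zero_mem _
  · funext K i
    change ∑ j, MvPolynomial.pderiv j (Matrix.diagonal (q K) i j) = f.1 K i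
    rw [Finset.sum_eq_single i (fun j _ hj => by
      rw [Matrix.diagonal_apply_ne _ hj.symm, map_zero]) (by simp), Matrix.diagonal_apply_eq, hqf]
  · refine Finset.sum_eq_zero fun K _ => ?_
    have h0 : ∀ i j, η.1 K i j * Matrix.diagonal (q K) i j = 0 := by
      intro i j
      rcases eq_or_ne i j with rfl | hij
      · have h1 := congrFun (congrFun (η.2.2 K) i) i
        simp only [Matrix.add_apply, Matrix.transpose_apply, Matrix.zero_apply] at h1
        rw [self_eq_neg.1 (eq_neg_of_add_eq_zero_left h1), zero_mul]
      · rw [Matrix.diagonal_apply_ne _ hij, mul_zero]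
    simp only [h0, Finset.sum_const_zero, map_zero]
  · rw [matForm_self, vecForm_self, Finset.mul_sum]
    refine Finset.sum_le_sum fun K _ => ?_
    rw [Finset.mul_sum]
    refine Finset.sum_le_sum fun i _ => ?_
    change ∑ j, cellInt K.1 (Matrix.diagonal (q K) i j * Matrix.diagonal (q K) i j) ≤ _
    rw [Finset.sum_eq_single i (fun j _ hj => by
      rw [Matrix.diagonal_apply_ne _ hj.symm, mul_zero, map_zero]) (by simp),
      Matrix.diagonal_apply_eq]
    exact hqB K i

end Forms

section Local

variable {n k : ℕ} {D : MixedDomain n} {T : SplitMesh D}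

/-! ### The local solution operators -/

instance : Module.Finite ℝ (stressSpace T k) :=
  Module.Finite.of_injective
    ({ toFun := fun τ K i j => ⟨τ.1 K i j, τ.2 K i j⟩
       map_add' := fun _ _ => rfl
       map_smul' := fun _ _ => rfl } : stressSpace T k →ₗ[ℝ]
        T.cells → Fin n → Fin n → MvPolynomial.restrictTotalDegree (Fin n) ℝ (k + 1))
    fun _ _ h => Subtype.ext <| funext fun K => funext fun i => funext fun j =>
      congrArg Subtype.val (congrFun (congrFun (congrFun h K) i) j)

instance : Module.Finite ℝ (dispSpace T k) :=
  Module.Finite.of_injective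
    ({ toFun := fun u K i => ⟨u.1 K i, u.2 K i⟩
       map_add' := fun _ _ => rfl
       map_smul' := fun _ _ => rfl } : dispSpace T k →ₗ[ℝ]
        T.cells → Fin n → MvPolynomial.restrictTotalDegree (Fin n) ℝ k)
    fun _ _ h => Subtype.ext <| funext fun K => funext fun i =>
      congrArg Subtype.val (congrFun (congrFun h K) i)

/-- A rotation as a stress. -/
def rotToStress (η : rotSpace T k) : stressSpace T k := ⟨η.1, η.2.1⟩

instance : Module.Finite ℝ (rotSpace T k) :=
  Module.Finite.of_injective
    ({ toFun := rotToStress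
       map_add' := fun _ _ => rfl
       map_smul' := fun _ _ => rfl } : rotSpace T k →ₗ[ℝ] stressSpace T k)
    fun _ _ h => Subtype.ext (congrArg (Subtype.val : stressSpace T k → BrokenMat T) h)

variable {ρS : ℝ} {L : Lame T}

theorem localForm_apply (x y : LocalSpace T k) :
    localForm k ρS L x y =
      matForm T (L.complianceMap x.1) y.1 + vecForm T x.2.1 (divMap T y.1) +
      matForm T x.2.2 y.1 + ρS⁻¹ * vecForm T (divMap T x.1) y.2.1 + matForm T x.1 y.2.2 := rfl

/-- A local problem with data `a`, `b`, `0` amounts to three equations. -/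
theorem localForm_eq_iff (x : LocalSpace T k) (a : stressSpace T k →ₗ[ℝ] ℝ)
    (b : dispSpace T k →ₗ[ℝ] ℝ) :
    (∀ y : LocalSpace T k, localForm k ρS L x y = a y.1 + b y.2.1) ↔
      (∀ υ : stressSpace T k, matForm T (L.complianceMap x.1) υ +
        vecForm T x.2.1 (divMap T υ) + matForm T x.2.2 υ = a υ) ∧
      (∀ ω : dispSpace T k, ρS⁻¹ * vecForm T (divMap T x.1) ω = b ω) ∧
      ∀ η : rotSpace T k, matForm T x.1 η = 0 := by
  refine ⟨fun h => ⟨fun υ => ?_, fun ω => ?_, fun η => ?_⟩, fun ⟨h1, h2, h3⟩ y => ?_⟩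
  · simpa [localForm_apply] using h (υ, 0, 0)
  · simpa [localForm_apply] using h (0, ω, 0)
  · simpa [localForm_apply] using h (0, 0, η)
  · rw [localForm_apply, h1, h2, h3, add_zero]

/-- Saddle-point uniqueness: energy definiteness removes the stress. A stress with divergence `u`
that is orthogonal to all rotations isolates the displacement; rotations are themselves stresses, so
the last multiplier can be tested with itself. -/
theorem localForm_injective (hn : 0 < n) (hρS : ρS ≠ 0) (hT : HasInscribedBalls T)
    (hdiv : ∀ f : dispSpace T k, ∃ τ : stressSpace T k, divMap T τ = f ∧
      ∀ η : rotSpace T k, matForm T η τ = 0) :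
    Function.Injective (localForm k ρS L) := by
  rw [injective_iff_map_eq_zero]
  intro x hx
  obtain ⟨h1, h2, h3⟩ := (localForm_eq_iff (ρS := ρS) (L := L) x 0 0).1 fun y => by simp [hx]
  simp only [LinearMap.zero_apply] at h1 h2
  have hu := h2 x.2.1
  rw [mul_eq_zero_iff_left (inv_ne_zero hρS)] at hu
  have hσ : x.1 = 0 := Subtype.ext (hT.eq_zero_of_compliance hn L (by
    have h := h1 x.1
    rwa [vecForm_comm, hu, add_zero, matForm_comm x.2.2.1, h3, add_zero] at h))
  simp only [hσ, Submodule.coe_zero, map_zero, LinearMap.zero_apply, zero_add] at h1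
  have hdisp : x.2.1 = 0 := by
    obtain ⟨τ, hτ, hη⟩ := hdiv x.2.1
    refine Subtype.ext (hT.eq_zero_of_vecForm (le_of_eq ?_))
    have h := h1 τ
    rwa [hτ, hη, add_zero] at h
  simp only [hdisp, Submodule.coe_zero, map_zero, LinearMap.zero_apply, zero_add] at h1
  have hrot : x.2.2 = 0 :=
    Subtype.ext (hT.eq_zero_of_matForm (h1 (rotToStress x.2.2)).le)
  exact Prod.ext hσ (Prod.ext hdisp hrot)

theorem bijective_of_injective_dual {V : Type*} [AddCommGroup V] [Module ℝ V] [Module.Finite ℝ V]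
    {f : V →ₗ[ℝ] Module.Dual ℝ V} (hf : Function.Injective f) : Function.Bijective f :=
  ⟨hf, (LinearMap.injective_iff_surjective_of_finrank_eq_finrank
    Subspace.dual_finrank_eq.symm).1 hf⟩

theorem localForm_localSolve (h : Function.Bijective (localForm k ρS L))
    (ℓ : Module.Dual ℝ (LocalSpace T k)) : localForm k ρS L (localSolve k ρS L ℓ) = ℓ := by
  rw [localSolve, dif_pos h]
  exact (LinearEquiv.ofBijective (localForm k ρS L) h).apply_symm_apply ℓ

theorem localForm_Q (h : Function.Bijective (localForm k ρS L)) (γ : traceSpace T k)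
    (y : LocalSpace T k) : localForm k ρS L (Q k ρS L γ) y = -traceForm T k γ y.1 := by
  rw [Q, LinearMap.comp_apply, localForm_localSolve h]
  rfl

theorem localForm_QL (h : Function.Bijective (localForm k ρS L)) (f : dispSpace T k)
    (y : LocalSpace T k) : localForm k ρS L (QL k ρS L f) y = -vecForm T f y.2.1 := by
  rw [QL, LinearMap.comp_apply, localForm_localSolve h]
  rfl

theorem Q_equations (h : Function.Bijective (localForm k ρS L)) (γ : traceSpace T k) :
    (∀ υ : stressSpace T k, matForm T (L.complianceMap (Q₁ k ρS L γ)) υ +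
        vecForm T (Q₂ k ρS L γ) (divMap T υ) + matForm T (Q₃ k ρS L γ) υ =
          -traceForm T k γ υ) ∧
      (∀ ω : dispSpace T k, ρS⁻¹ * vecForm T (divMap T (Q₁ k ρS L γ)) ω = 0) ∧
      ∀ η : rotSpace T k, matForm T (Q₁ k ρS L γ) η = 0 :=
  (localForm_eq_iff (Q k ρS L γ) (-traceForm T k γ) 0).1 fun y => by
    rw [localForm_Q h]
    simp

theorem QL_equations (h : Function.Bijective (localForm k ρS L)) (f : dispSpace T k) :
    (∀ υ : stressSpace T k, matForm T (L.complianceMap (QL₁ k ρS L f)) υ +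
        vecForm T (QL₂ k ρS L f) (divMap T υ) + matForm T (QL₃ k ρS L f) υ = 0) ∧
      (∀ ω : dispSpace T k, ρS⁻¹ * vecForm T (divMap T (QL₁ k ρS L f)) ω = -vecForm T f ω) ∧
      ∀ η : rotSpace T k, matForm T (QL₁ k ρS L f) η = 0 :=
  (localForm_eq_iff (QL k ρS L f) 0 (-(vecForm T f ∘ₗ (dispSpace T k).subtype))).1 fun y => by
    rw [localForm_QL h]
    simp

/-! ### Condensation -/

/-- The hybridized problem says that the volume unknowns solve the local problems, and that the
normal stresses are continuous. -/
theorem solvesHybrid_iff (h : Function.Bijective (localForm k ρS L)) (lamh : ℝ)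
    (x : LocalSpace T k) (γ : traceSpace T k) :
    SolvesHybrid ρS L lamh x.1 x.2.1 x.2.2 γ ↔
      x = Q k ρS L γ + lamh • QL k ρS L x.2.1 ∧ ∀ μ, traceForm T k μ x.1 = 0 := by
  -- Since `localForm` is injective, equality with the superposition can be tested against all `y`,
  -- where it splits into the first three equations.
  rw [← h.1.eq_iff, LinearMap.ext_iff]
  have hr : ∀ y : LocalSpace T k,
      localForm k ρS L (Q k ρS L γ + lamh • QL k ρS L x.2.1) y =
        (-traceForm T k γ) y.1 +
          (-(lamh • vecForm T x.2.1 ∘ₗ (dispSpace T k).subtype)) y.2.1 := by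
    intro y
    rw [map_add, map_smul, LinearMap.add_apply, LinearMap.smul_apply, localForm_Q h,
      localForm_QL h]
    simp
  simp only [hr]
  rw [localForm_eq_iff, and_assoc, and_assoc, SolvesHybrid]
  refine and_congr (forall_congr' fun υ => ?_) (and_congr (forall_congr' fun ω => ?_) Iff.rfl)
  · rw [LinearMap.neg_apply, eq_neg_iff_add_eq_zero]
  · simp only [LinearMap.neg_apply, LinearMap.smul_apply, LinearMap.comp_apply,
      Submodule.subtype_apply, smul_eq_mul]
    rw [neg_eq_iff_eq_neg]

/-- The jump of the normal component of a locally reconstructed stress is the residual of the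
condensed problem. -/
theorem traceForm_reconstruction (h : Function.Bijective (localForm k ρS L)) (hρS : ρS ≠ 0)
    (lamh : ℝ) (γ μ : traceSpace T k) (u : dispSpace T k) :
    traceForm T k μ (Q₁ k ρS L γ + lamh • QL₁ k ρS L u) =
      -(ρS * (condensedForm k ρS L γ μ - lamh * vecForm T u (Q₂ k ρS L μ))) := by
  obtain ⟨hγ1, hγ2, hγ3⟩ := Q_equations h γ
  obtain ⟨hμ1, hμ2, hμ3⟩ := Q_equations h μ
  obtain ⟨hu1, hu2, hu3⟩ := QL_equations h u
  -- Here `e1` gives `(𝒜𝒬₁γ, 𝒬₁μ) = -⟨μ, 𝒬₁γ ν⟩`. In `e2` the divergence of `𝒬₁ᴸu` produces `-ρ_S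
  -- (u, 𝒬₂μ)`, and `e3` says that its energy product with `𝒬₁μ` vanishes.
  have e1 := hμ1 (Q₁ k ρS L γ)
  have e2 := hμ1 (QL₁ k ρS L u)
  have e3 := hu1 (Q₁ k ρS L μ)
  have d1 := hγ2 (Q₂ k ρS L μ)
  have d2 := hu2 (Q₂ k ρS L μ)
  have d3 := hμ2 (QL₂ k ρS L u)
  rw [mul_eq_zero_iff_left (inv_ne_zero hρS)] at d1 d3
  rw [inv_mul_eq_iff_eq_mul₀ hρS] at d2
  rw [matForm_comm (Q₃ k ρS L μ).1, hγ3, vecForm_comm (Q₂ k ρS L μ).1, d1,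
    matForm_compliance_comm] at e1
  rw [matForm_comm (Q₃ k ρS L μ).1, hu3, vecForm_comm (Q₂ k ρS L μ).1, d2,
    matForm_compliance_comm] at e2
  rw [matForm_comm (QL₃ k ρS L u).1, hμ3, vecForm_comm (QL₂ k ρS L u).1, d3] at e3
  rw [map_add, map_smul, smul_eq_mul, condensedForm, mul_sub, mul_inv_cancel_left₀ hρS]
  linear_combination e1 + lamh * e2 - lamh * e3

/-! ### Invertibility of `I - λ 𝒬₂ᴸ` -/

/-- The energy identity for the local problems. -/
theorem vecForm_QL₂ (h : Function.Bijective (localForm k ρS L)) (hρS : ρS ≠ 0)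
    (f : dispSpace T k) : ρS * vecForm T f (QL₂ k ρS L f) =
      matForm T (L.complianceMap (QL₁ k ρS L f)) (QL₁ k ρS L f) := by
  obtain ⟨h1, h2, h3⟩ := QL_equations h f
  have e1 := h1 (QL₁ k ρS L f)
  have e2 := h2 (QL₂ k ρS L f)
  rw [inv_mul_eq_iff_eq_mul₀ hρS] at e2
  rw [matForm_comm (QL₃ k ρS L f).1, h3, vecForm_comm (QL₂ k ρS L f).1, e2] at e1
  linarith

/-- The stress of a local problem has the least energy among the weakly symmetric stresses with the
same divergence. -/
theorem vecForm_QL₂_le (hn : 0 < n) (h : Function.Bijective (localForm k ρS L)) (hρS : 0 < ρS)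
    {M B : ℝ} (hM : 0 < M) (hL : L.BoundedBy M)
    (hdiv : ∀ f : dispSpace T k, ∃ τ : stressSpace T k, divMap T τ = f ∧
      (∀ η : rotSpace T k, matForm T η τ = 0) ∧ matForm T τ τ ≤ B * vecForm T f f)
    (f : dispSpace T k) :
    vecForm T f (QL₂ k ρS L f) ≤ M * ρS * B * vecForm T f f := by
  -- The competitor has the divergence `-ρ_S f` prescribed by the local problem.
  obtain ⟨τ, hτ, hη, hτB⟩ := hdiv (-ρS • f)
  have hen := vecForm_QL₂ h hρS.ne' f
  have e1 := (QL_equations h f).1 τ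
  rw [hτ, hη] at e1
  simp only [Submodule.coe_smul, map_smul, LinearMap.smul_apply, smul_eq_mul] at e1 hτB
  rw [vecForm_comm (QL₂ k ρS L f).1] at e1
  -- By `e1` and `hen`, `(𝒜σ, τ) = (𝒜σ, σ)`; expanding `0 ≤ (𝒜(σ - τ), σ - τ)` then leaves `(𝒜σ, σ)
  -- ≤ (𝒜τ, τ)`.
  have hpos := matForm_compliance_self_nonneg hn L ((QL₁ k ρS L f).1 - τ.1)
  simp only [map_sub, LinearMap.sub_apply] at hpos
  rw [matForm_compliance_comm L τ.1] at hpos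
  have hup := hL.matForm_le hM τ.1
  have h1 : ρS * vecForm T f (QL₂ k ρS L f) ≤ ρS * (M * ρS * B * vecForm T f f) := by
    calc ρS * vecForm T f (QL₂ k ρS L f)
        ≤ M * matForm T τ τ := by linarith
      _ ≤ M * (B * (-ρS * (-ρS * vecForm T f f))) := by gcongr
      _ = ρS * (M * ρS * B * vecForm T f f) := by ring
  exact le_of_mul_le_mul_left h1 hρS

/-- In finite dimension a trivial kernel suffices. A kernel element satisfies `‖f‖² = λ (f, 𝒬₂ᴸ f)`:
for `λ ≤ 0` the right side is nonpositive, and otherwise it is at most `λ M ρ_S B ‖f‖²`, with a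
factor below one. -/
theorem isUnit_one_sub_QL₂ (hn : 0 < n) (h : Function.Bijective (localForm k ρS L)) (hρS : 0 < ρS)
    (hT : HasInscribedBalls T) {M B : ℝ} (hM : 0 < M) (hL : L.BoundedBy M)
    (hdiv : ∀ f : dispSpace T k, ∃ τ : stressSpace T k, divMap T τ = f ∧
      (∀ η : rotSpace T k, matForm T η τ = 0) ∧ matForm T τ τ ≤ B * vecForm T f f)
    {lamh : ℝ} (hlam : lamh * (M * ρS * B) < 1) : IsUnit (1 - lamh • QL₂ k ρS L) := by
  rw [LinearMap.isUnit_iff_ker_eq_bot, LinearMap.ker_eq_bot']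
  intro f hf
  have hf' : f = lamh • QL₂ k ρS L f := sub_eq_zero.1 hf
  have hff : vecForm T f f = lamh * vecForm T f (QL₂ k ρS L f) := by
    conv_lhs => arg 2; rw [hf']
    rw [Submodule.coe_smul, map_smul, smul_eq_mul]
  have hf0 := vecForm_self_nonneg f.1
  refine Subtype.ext (hT.eq_zero_of_vecForm ?_)
  rcases le_total lamh 0 with hl | hl
  · have h0 := matForm_compliance_self_nonneg hn L (QL₁ k ρS L f).1
    rw [← vecForm_QL₂ h hρS.ne'] at h0
    rw [hff]
    exact mul_nonpos_of_nonpos_of_nonneg hl (nonneg_of_mul_nonneg_right h0 hρS)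
  · have h1 := mul_le_mul_of_nonneg_left (vecForm_QL₂_le hn h hρS hM hL hdiv f) hl
    rw [← hff] at h1
    by_contra hlt
    rw [not_le] at hlt
    nlinarith

/-! ### Reconstruction and equivalence of the two eigenproblems -/

theorem one_sub_apply_recDisp {lamh : ℝ} (hU : IsUnit (1 - lamh • QL₂ k ρS L))
    (γ : traceSpace T k) : recDisp k ρS L lamh γ =
      Q₂ k ρS L γ + lamh • QL₂ k ρS L (recDisp k ρS L lamh γ) := by
  have h1 := congrArg (fun A : Module.End ℝ (dispSpace T k) => A (Q₂ k ρS L γ))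
    (Ring.mul_inverse_cancel _ hU)
  simp only [Module.End.mul_apply, Module.End.one_apply, LinearMap.sub_apply,
    LinearMap.smul_apply] at h1
  exact sub_eq_iff_eq_add.1 h1

theorem eq_recDisp {lamh : ℝ} (hU : IsUnit (1 - lamh • QL₂ k ρS L)) {γ : traceSpace T k}
    {u : dispSpace T k} (hu : u = Q₂ k ρS L γ + lamh • QL₂ k ρS L u) :
    u = recDisp k ρS L lamh γ := by
  have h1 := congrArg (fun A : Module.End ℝ (dispSpace T k) => A u) (Ring.inverse_mul_cancel _ hU)
  simp only [Module.End.mul_apply, Module.End.one_apply, LinearMap.sub_apply,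
    LinearMap.smul_apply] at h1
  rw [← h1, recDisp]
  congr 1
  rw [sub_eq_iff_eq_add]
  exact hu

theorem solvesCondensed_iff (h : Function.Bijective (localForm k ρS L)) (hρS : ρS ≠ 0) {lamh : ℝ}
    (hU : IsUnit (1 - lamh • QL₂ k ρS L)) (γ : traceSpace T k) :
    SolvesCondensed k ρS L lamh γ ↔
      SolvesHybrid ρS L lamh (recStress k ρS L lamh γ) (recDisp k ρS L lamh γ)
        (recRot k ρS L lamh γ) γ := by
  have hrec := one_sub_apply_recDisp hU γ
  have key := solvesHybrid_iff h lamh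
    (recStress k ρS L lamh γ, recDisp k ρS L lamh γ, recRot k ρS L lamh γ) γ
  rw [key]
  have hx : (recStress k ρS L lamh γ, recDisp k ρS L lamh γ, recRot k ρS L lamh γ) =
      Q k ρS L γ + lamh • QL k ρS L (recDisp k ρS L lamh γ) :=
    -- Stress and rotation match by definition; only the displacement needs its fixed-point
    -- equation.
    Prod.ext rfl (Prod.ext hrec rfl)
  simp only [← hx, true_and]
  refine forall_congr' fun μ => ?_
  rw [recStress, traceForm_reconstruction h hρS lamh γ μ _, neg_eq_zero, mul_eq_zero,
    or_iff_right hρS, sub_eq_zero]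
  rfl

theorem SolvesHybrid.eq_reconstruction (h : Function.Bijective (localForm k ρS L)) {lamh : ℝ}
    (hU : IsUnit (1 - lamh • QL₂ k ρS L)) {σ : stressSpace T k} {u : dispSpace T k}
    {ρ : rotSpace T k} {γ : traceSpace T k} (hs : SolvesHybrid ρS L lamh σ u ρ γ) :
    u = recDisp k ρS L lamh γ ∧ σ = recStress k ρS L lamh γ ∧ ρ = recRot k ρS L lamh γ := by
  have hx := ((solvesHybrid_iff h lamh (σ, u, ρ) γ).1 hs).1
  have hu : u = recDisp k ρS L lamh γ := eq_recDisp hU (congrArg (fun x => x.2.1) hx)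
  refine ⟨hu, ?_, ?_⟩
  · rw [recStress, ← hu]
    exact congrArg (fun x => x.1) hx
  · rw [recRot, ← hu]
    exact congrArg (fun x => x.2.2) hx

/-- The reconstruction is linear in `γ`, so a vanishing trace annihilates all volume unknowns. -/
theorem SolvesHybrid.trace_ne_zero (h : Function.Bijective (localForm k ρS L)) {lamh : ℝ}
    (hU : IsUnit (1 - lamh • QL₂ k ρS L)) {σ : stressSpace T k} {u : dispSpace T k}
    {ρ : rotSpace T k} {γ : traceSpace T k} (hne : (σ, u, ρ, γ) ≠ 0)
    (hs : SolvesHybrid ρS L lamh σ u ρ γ) : γ ≠ 0 := by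
  rintro rfl
  obtain ⟨hu, hσ, hρ⟩ := hs.eq_reconstruction h hU
  have hu0 : recDisp k ρS L lamh (0 : traceSpace T k) = 0 := by rw [recDisp, map_zero, map_zero]
  rw [recStress, hu0, map_zero, map_zero, smul_zero, add_zero] at hσ
  rw [recRot, hu0, map_zero, map_zero, smul_zero, add_zero] at hρ
  rw [hu0] at hu
  exact hne (by rw [hu, hσ, hρ]; rfl)

end Local

end

end HybridElasticity

/-! ### The main theorem -/

theorem mainTheorem7 (n k : ℕ) (hn : n = 2 ∨ n = 3) (hk : 1 ≤ k) (ρS κ M : ℝ)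
    (hρS : 0 < ρS) (hκ : 0 < κ) (hM : 0 < M) :
    ∃ Cstar : ℝ, 0 < Cstar ∧
      ∀ (D : HybridElasticity.MixedDomain n) (T : HybridElasticity.SplitMesh D)
        (L : HybridElasticity.Lame T),
        T.QuasiUniform κ → L.BoundedBy M →
        Function.Bijective (HybridElasticity.localForm k ρS L) ∧
        ∀ lamh : ℝ, lamh ≤ Cstar / T.meshSize ^ 2 →
          IsUnit (1 - lamh • HybridElasticity.QL₂ k ρS L) ∧
          (∀ γ : HybridElasticity.traceSpace T k, γ ≠ 0 →
            (HybridElasticity.SolvesCondensed k ρS L lamh γ ↔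
              HybridElasticity.SolvesHybrid ρS L lamh
                (HybridElasticity.recStress k ρS L lamh γ)
                (HybridElasticity.recDisp k ρS L lamh γ)
                (HybridElasticity.recRot k ρS L lamh γ) γ)) ∧
          (∀ (σ : HybridElasticity.stressSpace T k) (u : HybridElasticity.dispSpace T k)
            (ρ : HybridElasticity.rotSpace T k) (γ : HybridElasticity.traceSpace T k),
            (σ, u, ρ, γ) ≠ 0 → HybridElasticity.SolvesHybrid ρS L lamh σ u ρ γ →
              γ ≠ 0 ∧ u = HybridElasticity.recDisp k ρS L lamh γ ∧
                σ = HybridElasticity.recStress k ρS L lamh γ ∧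
                ρ = HybridElasticity.recRot k ρS L lamh γ) := by
  have hn0 : 0 < n := by omega
  have hδ : 0 < κ / ((n : ℝ) + 1) ^ 2 := by positivity
  obtain ⟨C, hC, hanti⟩ := HybridElasticity.exists_antideriv_bound n k hδ
  -- Invertibility needs `λ M ρ_S C h² < 1`; the factor `2` makes the inequality strict even at `λ =
  -- C⋆ h⁻²`.
  refine ⟨1 / (2 * (M * ρS * C)), by positivity, fun D T L hT hL => ?_⟩
  have hballs : HybridElasticity.HasInscribedBalls T := fun K => by
    obtain ⟨hh, c, hc, -⟩ := hT.exists_closedBall hn0 hκ K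
    exact ⟨c, _, mul_pos hh hδ, hc⟩
  have hdiv := HybridElasticity.exists_diagonal_divMap_eq (T := T) (k := k)
    (B := C * T.meshSize ^ 2) fun K i p hp => by
      obtain ⟨hh, c, hin, hout⟩ := hT.exists_closedBall hn0 hκ K
      exact hanti K.1 c T.meshSize hh hin hout i p hp
  have hbij : Function.Bijective (HybridElasticity.localForm k ρS L) :=
    HybridElasticity.bijective_of_injective_dual <|
      HybridElasticity.localForm_injective hn0 hρS.ne' hballs fun f => by
        obtain ⟨τ, h1, h2, -⟩ := hdiv f
        exact ⟨τ, h1, h2⟩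
  refine ⟨hbij, fun lamh hlam => ?_⟩
  have hsmall : lamh * (M * ρS * (C * T.meshSize ^ 2)) < 1 := by
    -- A zero mesh size need not be excluded here: the product to be bounded is then zero.
    rcases (sq_nonneg T.meshSize).eq_or_lt with h0 | h0
    · simp [← h0]
    · rw [le_div_iff₀ h0] at hlam
      calc lamh * (M * ρS * (C * T.meshSize ^ 2))
          = lamh * T.meshSize ^ 2 * (M * ρS * C) := by ring
        _ ≤ 1 / (2 * (M * ρS * C)) * (M * ρS * C) := by gcongr
        _ = 1 / 2 := by field_simp
        _ < 1 := by norm_num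
  have hU := HybridElasticity.isUnit_one_sub_QL₂ hn0 hbij hρS hballs hM hL hdiv hsmall
  exact ⟨hU, fun γ _ => HybridElasticity.solvesCondensed_iff hbij hρS.ne' hU γ,
    fun σ u ρ γ hne hs => ⟨hs.trace_ne_zero hbij hU hne, hs.eq_reconstruction hbij hU⟩⟩
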